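/- A model of Peano arithmetic PA is a structure $(M,0,1,+,\cdot,<)$ satisfying the axioms of $\mathrm{PA}^-$ (that is, $M$ is the nonnegative part of a discretely ordered commutative ring) and the induction scheme for all first-order formulas, with parameters, in this language. It is $\omega_1$-like if it is uncountable but every proper initial segment of $(M,<)$ is countable. The standard system of a nonstandard model $M$ of PA is $\mathrm{SS}(M)=\{r(a):a\in M\}$, where $r(a)=\{n\in\mathbb N:\text{the }n\text{th prime divides }a\}$. The real closure $R(M)$ is the real closure of the ordered fraction field of the ordered ring generated by $M$. For a real closed field $K$, the standard valuation $v:K^\times\to v(K)$ is the valuation whose valuation ring is the ring of finite elements of $K$, i.e. those bounded in absolute value by a natural number: $v(x)\le v(y)$ if and only if $y/x$ is finite. Its value group $v(K)$ is a (linearly) ordered abelian group. **Theorem.** If $M$ and $N$ are $\omega_1$-like models of PA with $\mathrm{SS}(M)=\mathrm{SS}(N)$, then the value groups $v(R(M))$ and $v(R(N))$ are isomorphic as ordered groups. -/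

import Mathlib

/-- Function symbols of the language of arithmetic. -/
inductive ArithFunc : ℕ → Type
  | zero : ArithFunc 0
  | one : ArithFunc 0
  | add : ArithFunc 2
  | mul : ArithFunc 2

/-- Relation symbols of the language of arithmetic. -/
inductive ArithRel : ℕ → Type
  | lt : ArithRel 2

/-- The first-order language of arithmetic `{0, 1, +, ·, <}`. -/
def arithLang : FirstOrder.Language where
  Functions := ArithFunc
  Relations := ArithRel

/-- The standard interpretation of the language of arithmetic in an ordered semiring. -/
instance arithStructure (M : Type*) [CommSemiring M] [LinearOrder M] : arithLang.Structure M where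
  funMap
    | .zero, _ => 0
    | .one, _ => 1
    | .add, v => v 0 + v 1
    | .mul, v => v 0 * v 1
  RelMap
    | .lt, v => v 0 < v 1

/-- `M` is a model of (first-order) Peano arithmetic: it satisfies the axioms `PA⁻`, that is, it is
the nonnegative part of a discretely ordered commutative ring, and the induction scheme. -/
class IsPeanoModel (M : Type*) [CommSemiring M] [LinearOrder M] : Prop
    extends IsStrictOrderedRing M, CanonicallyOrderedAdd M where
  /-- The order is discrete: there is nothing strictly between `0` and `1`. -/
  one_le_of_pos : ∀ x : M, 0 < x → 1 ≤ x
  /-- Induction for all first-order formulas `φ(p₁, …, pₙ, x)` of arithmetic, with arbitrary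
  parameters `p₁, …, pₙ` from `M`. -/
  induction : ∀ (n : ℕ) (φ : arithLang.Formula (Fin n ⊕ Unit)) (p : Fin n → M),
    φ.Realize (Sum.elim p fun _ => 0) →
    (∀ x : M, φ.Realize (Sum.elim p fun _ => x) → φ.Realize (Sum.elim p fun _ => x + 1)) →
    ∀ x : M, φ.Realize (Sum.elim p fun _ => x)

/-- A linear order is `ω₁`-like if it is uncountable but every proper initial segment is
countable. -/
def IsOmegaOneLike (α : Type*) [LinearOrder α] : Prop :=
  Uncountable α ∧ ∀ s : Set α, IsLowerSet s → s ≠ Set.univ → s.Countable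

/-- The standard system of a (nonstandard) model of arithmetic `M`: the family of all sets
`{n ∈ ℕ : the n-th prime divides a}`, for `a ∈ M`. -/
def standardSystem (M : Type*) [CommSemiring M] : Set (Set ℕ) :=
  Set.range fun a : M => {n : ℕ | ((Nat.nth Nat.Prime n : ℕ) : M) ∣ a}

/-- `K`, with the order-preserving embedding `i : M → K`, is the real closure of `M`: it is a real
closed field, and it is algebraic over the subfield generated by the image of `M`, i.e. over the
ordered fraction field of (the ordered ring generated by) `M`. -/
structure IsRealClosure {M K : Type*} [CommSemiring M] [LinearOrder M] [Field K] [LinearOrder K]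
    [IsStrictOrderedRing K] (i : M →+* K) : Prop where
  strictMono : StrictMono i
  isRealClosed : IsRealClosed K
  isAlgebraic : Algebra.IsAlgebraic (Subfield.closure (Set.range i)) K

/-- The value group `v(K)` of an ordered field `K` under the standard valuation
`ArchimedeanClass.addValuation K`, the one with `v x ≤ v y` iff `y / x` is finite (bounded in
absolute value by a natural number) for `x, y ≠ 0`. The type `ArchimedeanClass K` consists of
the group `v(K)`, written additively, and an extra top element `v 0`, the only noninvertible
one; so `v(K)` is its group of additive units, with the induced linear order. -/
abbrev StandardValueGroup (K : Type*) [Field K] [LinearOrder K] [IsStrictOrderedRing K] : Type _ :=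
  AddUnits (ArchimedeanClass K)

/-! Up to sign, the standard valuation restricted to `M` is a logarithm read modulo finite elements:
products become sums, and `a` lies below `b` as soon as `a ≤ n * b` for some standard `n`
(`IsLogarithm`). Since `R(M)` is algebraic over the fraction field of `M`, some positive multiple of
each value is a difference of two such logarithms. Inside `M` every nonzero element is within a
factor 2 of a power of two, and powers of two have `n`-th roots up to the factor `2 ^ n`; so every
nonnegative value is the logarithm of a power of two. The value group is therefore an ordered
`ℚ`-vector space, and it is uncountable with countable bounded intervals because `M` is `ω₁`-like.

What remains is an isomorphism theorem for two such spaces,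
`OrderedRatModule.nonempty_orderAddMonoidIso`. A maximal isomorphism between convex subspaces is
total, because an isomorphism between countable ones extends by a countable back-and-forth. In that
argument only finitely many archimedean classes are new at each stage, so an element `y` to be added
has a best approximation in the current domain. After subtracting it, either `y` lies in an old
class, and a ratio has to be realized on the other side, or its class is new, and a gap between
classes has to be filled.

Arithmetic supplies three facts. Archimedean classes of nonzero elements are dense, by overspill
(`exists_between_pow`). A function growing more slowly than every root, yet unbounded
(`exists_slow_growth`), provides enough convex subspaces whose complement has no least class.
Finally, the cut of ratios of two logarithms is the trace on `ℕ` of a definable relation; the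
standard system determines which traces occur, so `M` and `N` realize the same ratios
(`exists_pow_le_iff`).

Archimedean classes are ordered in reverse: `mk y < mk x` means that `y` is infinitely larger than
`x`. -/

set_option linter.unusedSectionVars false

open ArchimedeanClass

/-! ### Ordered rational vector spaces: archimedean classes and best approximations -/

namespace OrderedRatModule

section Basic

variable {G : Type*} [AddCommGroup G] [LinearOrder G] [IsOrderedAddMonoid G] [Module ℚ G]

theorem smul_pos_of_pos {q : ℚ} (hq : 0 < q) {x : G} (hx : 0 < x) : 0 < q • x := by
  by_contra! h
  have h1 : q.den • (q • x) = q.num.toNat • x := by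
    have h2 : ((q.num.toNat : ℕ) : ℚ) = q.num := by
      exact_mod_cast Int.toNat_of_nonneg (Rat.num_pos.2 hq).le
    rw [← Nat.cast_smul_eq_nsmul ℚ, ← Nat.cast_smul_eq_nsmul ℚ, smul_smul, h2,
      Rat.den_mul_eq_num]
  have h3 : 0 < q.num.toNat := by
    have := Rat.num_pos.2 hq
    omega
  have h4 : 0 < q.num.toNat • x := nsmul_pos hx h3.ne'
  exact absurd (h1 ▸ nsmul_nonpos h q.den) (not_le.2 h4)

instance posSMulStrictMono : PosSMulStrictMono ℚ G where
  smul_lt_smul_of_pos_left q hq a b hab := by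
    have := smul_pos_of_pos hq (sub_pos.2 hab)
    rwa [smul_sub, sub_pos] at this

/-- A set containing with each element all the elements of smaller absolute value. -/
def IsAbsConvex (V : Set G) : Prop :=
  ∀ ⦃a b : G⦄, b ∈ V → |a| ≤ |b| → a ∈ V

theorem IsAbsConvex.mk_lt_mk {V : Submodule ℚ G} (hV : IsAbsConvex (V : Set G)) {a b : G}
    (ha : a ∉ V) (hb : b ∈ V) : mk a < mk b := by
  rw [ArchimedeanClass.mk_lt_mk]
  intro n
  by_contra! h
  refine ha (hV (nsmul_mem hb n) ?_)
  rwa [abs_nsmul]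

theorem mk_smul {q : ℚ} (hq : q ≠ 0) (x : G) : mk (q • x) = mk x := by
  have key : ∀ {q : ℚ} (_ : q ≠ 0) (x : G), mk x ≤ mk (q • x) := by
    intro q hq x
    rw [ArchimedeanClass.mk_le_mk]
    obtain ⟨n, hn⟩ := exists_nat_ge |q|
    refine ⟨n, ?_⟩
    have h1 : 0 ≤ ((n : ℚ) - |q|) • |x| := smul_nonneg (sub_nonneg.2 hn) (abs_nonneg x)
    rw [sub_smul, Nat.cast_smul_eq_nsmul, sub_nonneg] at h1
    refine le_trans (le_of_eq ?_) h1
    rcases le_total 0 q with h | h <;> rcases le_total 0 x with h' | h'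
    · rw [abs_of_nonneg h, abs_of_nonneg h', abs_of_nonneg (smul_nonneg h h')]
    · rw [abs_of_nonneg h, abs_of_nonpos h',
        abs_of_nonpos (smul_nonpos_of_nonneg_of_nonpos h h'), smul_neg]
    · have h2 := smul_nonneg (neg_nonneg.2 h) h'
      rw [neg_smul] at h2
      rw [abs_of_nonpos h, abs_of_nonneg h', abs_of_nonpos (neg_nonneg.1 h2), neg_smul]
    · have h2 := smul_nonneg (neg_nonneg.2 h) (neg_nonneg.2 h')
      rw [neg_smul_neg] at h2
      rw [abs_of_nonpos h, abs_of_nonpos h', abs_of_nonneg h2, neg_smul_neg]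
  refine le_antisymm ?_ (key hq x)
  have := key (inv_ne_zero hq) (q • x)
  rwa [smul_smul, inv_mul_cancel₀ hq, one_smul] at this

/-- If `y` lies outside `V` and the classes of the differences of elements of `V` outside a
subspace `U` are finitely many, then `y` has a best approximation in `V`. -/
theorem exists_best_approximation {U V : Submodule ℚ G} (hU : IsAbsConvex (U : Set G))
    (hUV : U ≤ V) (hfin : (mk '' {a : G | a ∈ V ∧ a ∉ U}).Finite) {y : G} (hy : y ∉ V) :
    ∃ u ∈ V, ∀ u' ∈ V, mk (y - u') ≤ mk (y - u) := by
  by_contra! h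
  -- If `u'` approximates `y` better than `u`, then `u' - u` has the class of `y - u`. So all
  -- approximation errors have classes in a finite set, and one of them is maximal.
  have hsub : (fun u => mk (y - u)) '' (V : Set G) ⊆ mk '' {a : G | a ∈ V ∧ a ∉ U} := by
    rintro _ ⟨u, hu, rfl⟩
    obtain ⟨u', hu', hlt⟩ := h u hu
    have h1 : mk (u' - u) = mk (y - u) := by
      have h2 : u' - u = (y - u) - (y - u') := by abel
      rw [h2]
      exact mk_sub_eq_mk_left hlt
    refine ⟨u' - u, ⟨V.sub_mem hu' hu, fun h3 => ?_⟩, h1⟩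
    -- If `u' - u` were in `U`, convexity would put `y - u` in `U`, hence `y` in `V`.
    have h4 : mk (u' - u) ≤ mk (y - u) := h1.le
    rw [ArchimedeanClass.mk_le_mk] at h4
    obtain ⟨n, hn⟩ := h4
    rw [← abs_nsmul] at hn
    have h5 := hUV (hU (nsmul_mem h3 n) hn)
    exact hy (by simpa using V.add_mem h5 hu)
  have hne : ((fun u => mk (y - u)) '' (V : Set G)).Nonempty := ⟨_, 0, V.zero_mem, rfl⟩
  obtain ⟨c, ⟨u, hu, rfl⟩, hmax⟩ := (hfin.subset hsub).exists_maximal hne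
  obtain ⟨u', hu', hlt⟩ := h u hu
  exact absurd (hmax ⟨u', hu', rfl⟩ hlt.le) (not_le.2 hlt)

end Basic

/-! ### Partial isomorphisms as graphs -/

variable {G H : Type*} [AddCommGroup G] [LinearOrder G] [IsOrderedAddMonoid G] [Module ℚ G]
  [AddCommGroup H] [LinearOrder H] [IsOrderedAddMonoid H] [Module ℚ H]

/-- The submodule `Γ` of `G × H` is the graph of an ordered isomorphism between submodules of
`G` and of `H`. -/
def IsPartialIso (Γ : Submodule ℚ (G × H)) : Prop :=
  ∀ z ∈ Γ, 0 < z.1 ↔ 0 < z.2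

/-- The domain of a partial isomorphism. -/
def dom (Γ : Submodule ℚ (G × H)) : Submodule ℚ G := Γ.map (LinearMap.fst ℚ G H)

/-- The range of a partial isomorphism. -/
def ran (Γ : Submodule ℚ (G × H)) : Submodule ℚ H := Γ.map (LinearMap.snd ℚ G H)

/-- The inverse of a partial isomorphism. -/
def swap (Γ : Submodule ℚ (G × H)) : Submodule ℚ (H × G) :=
  Γ.comap (LinearEquiv.prodComm ℚ H G).toLinearMap

theorem mem_dom {Γ : Submodule ℚ (G × H)} {a : G} : a ∈ dom Γ ↔ ∃ b, (a, b) ∈ Γ := by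
  simp [dom]

theorem mem_ran {Γ : Submodule ℚ (G × H)} {b : H} : b ∈ ran Γ ↔ ∃ a, (a, b) ∈ Γ := by
  simp [ran]

theorem mem_swap {Γ : Submodule ℚ (G × H)} {z : H × G} : z ∈ swap Γ ↔ (z.2, z.1) ∈ Γ := by
  simp [swap, Prod.swap]

theorem dom_mono {Γ Δ : Submodule ℚ (G × H)} (h : Γ ≤ Δ) : dom Γ ≤ dom Δ := Submodule.map_mono h

theorem ran_mono {Γ Δ : Submodule ℚ (G × H)} (h : Γ ≤ Δ) : ran Γ ≤ ran Δ := Submodule.map_mono h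

theorem swap_mono {Γ Δ : Submodule ℚ (G × H)} (h : Γ ≤ Δ) : swap Γ ≤ swap Δ :=
  Submodule.comap_mono h

theorem swap_swap (Γ : Submodule ℚ (G × H)) : swap (swap Γ) = Γ := by
  ext z
  simp [mem_swap]

theorem dom_swap (Γ : Submodule ℚ (G × H)) : dom (swap Γ) = ran Γ := by
  ext z
  simp [mem_swap, mem_dom, mem_ran]

theorem ran_swap (Γ : Submodule ℚ (G × H)) : ran (swap Γ) = dom Γ := by
  ext z
  simp [mem_swap, mem_dom, mem_ran]

namespace IsPartialIso

variable {Γ : Submodule ℚ (G × H)} {a a' : G} {b b' : H}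

theorem swap (hΓ : IsPartialIso Γ) : IsPartialIso (swap Γ) :=
  fun _ hz => (hΓ _ (mem_swap.1 hz)).symm

theorem lt_iff (hΓ : IsPartialIso Γ) (h : (a, b) ∈ Γ) (h' : (a', b') ∈ Γ) : a < a' ↔ b < b' := by
  simpa using hΓ _ (Γ.sub_mem h' h)

theorem le_iff (hΓ : IsPartialIso Γ) (h : (a, b) ∈ Γ) (h' : (a', b') ∈ Γ) : a ≤ a' ↔ b ≤ b' := by
  rw [← not_lt, ← not_lt, hΓ.lt_iff h' h]

theorem eq_iff (hΓ : IsPartialIso Γ) (h : (a, b) ∈ Γ) (h' : (a', b') ∈ Γ) : a = a' ↔ b = b' := by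
  rw [le_antisymm_iff, le_antisymm_iff, hΓ.le_iff h h', hΓ.le_iff h' h]

theorem abs_mem (hΓ : IsPartialIso Γ) (h : (a, b) ∈ Γ) : (|a|, |b|) ∈ Γ := by
  have h0 : ((0 : G), (0 : H)) ∈ Γ := Γ.zero_mem
  rcases le_total 0 a with ha | ha
  · rwa [abs_of_nonneg ha, abs_of_nonneg ((hΓ.le_iff h0 h).1 ha)]
  · rw [abs_of_nonpos ha, abs_of_nonpos ((hΓ.le_iff h h0).1 ha)]
    exact Γ.neg_mem h

theorem mk_le_mk_iff (hΓ : IsPartialIso Γ) (h : (a, b) ∈ Γ) (h' : (a', b') ∈ Γ) :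
    mk a ≤ mk a' ↔ mk b ≤ mk b' := by
  rw [ArchimedeanClass.mk_le_mk, ArchimedeanClass.mk_le_mk]
  exact exists_congr fun n => hΓ.le_iff (hΓ.abs_mem h') (nsmul_mem (hΓ.abs_mem h) n)

theorem mk_lt_mk_iff (hΓ : IsPartialIso Γ) (h : (a, b) ∈ Γ) (h' : (a', b') ∈ Γ) :
    mk a < mk a' ↔ mk b < mk b' := by
  rw [← not_le, ← not_le, hΓ.mk_le_mk_iff h' h]

theorem notMem_ran (hΓ : IsPartialIso Γ) {Δ : Submodule ℚ (G × H)} (hle : Δ ≤ Γ)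
    (h : (a, b) ∈ Γ) (ha : a ∉ dom Δ) : b ∉ ran Δ := by
  intro hb
  obtain ⟨a', ha'⟩ := mem_ran.1 hb
  have := (hΓ.eq_iff h (hle ha')).2 rfl
  exact ha (mem_dom.2 ⟨b, this ▸ ha'⟩)

/-- Partial isomorphisms preserve and reflect comparison of classes, so finiteness of the set of new
classes passes from the domain to the range. This makes the back-and-forth symmetric under `swap`.
-/
theorem finite_ran (hΓ : IsPartialIso Γ) {Δ : Submodule ℚ (G × H)} (hle : Δ ≤ Γ)
    (hfin : (mk '' {a : G | a ∈ dom Γ ∧ a ∉ dom Δ}).Finite) :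
    (mk '' {b : H | b ∈ ran Γ ∧ b ∉ ran Δ}).Finite := by
  classical
  have hch : ∀ a : G, ∃ b : H, a ∈ dom Γ → (a, b) ∈ Γ := fun a => by
    by_cases ha : a ∈ dom Γ
    · obtain ⟨b, hb⟩ := mem_dom.1 ha
      exact ⟨b, fun _ => hb⟩
    · exact ⟨0, fun h => absurd h ha⟩
  choose f hf using hch
  obtain ⟨t, ht, hts⟩ := Set.exists_subset_bijOn {a : G | a ∈ dom Γ ∧ a ∉ dom Δ} mk
  have htf : t.Finite := hts.finite_iff_finite.2 hfin
  refine (htf.image fun a => mk (f a)).subset ?_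
  rintro _ ⟨b, ⟨hb, hb'⟩, rfl⟩
  obtain ⟨a, ha⟩ := mem_ran.1 hb
  have had : a ∉ dom Δ := by
    intro h
    rw [← dom_swap] at hb
    refine hΓ.swap.notMem_ran (swap_mono hle) (mem_swap.2 ha) (a := b) ?_ (by rwa [ran_swap])
    rwa [dom_swap]
  obtain ⟨a', ha', heq⟩ := hts.surjOn ⟨a, ⟨mem_dom.2 ⟨b, ha⟩, had⟩, rfl⟩
  have hf' := hf a' (ht ha').1
  exact ⟨a', ha', le_antisymm ((hΓ.mk_le_mk_iff hf' ha).1 heq.le)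
    ((hΓ.mk_le_mk_iff ha hf').1 heq.ge)⟩

/-- A partial isomorphism is extended by sending `y` to an element `y'` filling the image of the
cut that `y` fills. -/
theorem sup_span (hΓ : IsPartialIso Γ) {y : G} {y' : H}
    (hlt : ∀ a b, (a, b) ∈ Γ → a < y → b < y') (hgt : ∀ a b, (a, b) ∈ Γ → y < a → y' < b)
    (hy : y ∉ dom Γ) : IsPartialIso (Γ ⊔ Submodule.span ℚ {(y, y')}) := by
  have hlt' : ∀ a b, (a, b) ∈ Γ → (a < y ↔ b < y') := fun a b h =>
    ⟨hlt a b h, fun hb => by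
      rcases lt_trichotomy a y with h1 | h1 | h1
      · exact h1
      · exact absurd (mem_dom.2 ⟨b, h1 ▸ h⟩) hy
      · exact absurd hb (hgt a b h h1).not_gt⟩
  have hgt' : ∀ a b, (a, b) ∈ Γ → (y < a ↔ y' < b) := fun a b h =>
    ⟨hgt a b h, fun hb => by
      rcases lt_trichotomy a y with h1 | h1 | h1
      · exact absurd hb (hlt a b h h1).not_gt
      · exact absurd (mem_dom.2 ⟨b, h1 ▸ h⟩) hy
      · exact h1⟩
  intro z hz
  obtain ⟨⟨a, b⟩, hab, w, hw, rfl⟩ := Submodule.mem_sup.1 hz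
  obtain ⟨q, rfl⟩ := Submodule.mem_span_singleton.1 hw
  simp only [Prod.smul_mk, Prod.mk_add_mk]
  have hmem := Γ.smul_mem (-q⁻¹) hab
  rw [Prod.smul_mk] at hmem
  -- Factoring out `q` reduces the sign of `a + q • y` to the position of `y` relative to `-q⁻¹ •
  -- a`, which lies in the domain.
  have hG : ∀ {q : ℚ}, q ≠ 0 → a + q • y = q • (y - -q⁻¹ • a) := fun {q} hq => by
    rw [smul_sub, smul_smul, mul_neg, mul_inv_cancel₀ hq, neg_smul, one_smul]; abel
  have hH : ∀ {q : ℚ}, q ≠ 0 → b + q • y' = q • (y' - -q⁻¹ • b) := fun {q} hq => by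
    rw [smul_sub, smul_smul, mul_neg, mul_inv_cancel₀ hq, neg_smul, one_smul]; abel
  rcases lt_trichotomy q 0 with hq | rfl | hq
  · rw [hG hq.ne, hH hq.ne]
    have e1 : 0 < q • (y - -q⁻¹ • a) ↔ y - -q⁻¹ • a < 0 := by
      rw [← neg_smul_neg, smul_pos_iff_of_pos_left (neg_pos.2 hq), neg_pos]
    have e2 : 0 < q • (y' - -q⁻¹ • b) ↔ y' - -q⁻¹ • b < 0 := by
      rw [← neg_smul_neg, smul_pos_iff_of_pos_left (neg_pos.2 hq), neg_pos]
    rw [e1, e2, sub_neg, sub_neg]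
    exact hgt' _ _ hmem
  · simpa using hΓ _ hab
  · rw [hG hq.ne', hH hq.ne', smul_pos_iff_of_pos_left hq, smul_pos_iff_of_pos_left hq,
      sub_pos, sub_pos]
    exact hlt' _ _ hmem

end IsPartialIso

end OrderedRatModule

/-! ### Extending a partial isomorphism by one element -/

namespace OrderedRatModule

variable {G H : Type*} [AddCommGroup G] [LinearOrder G] [IsOrderedAddMonoid G] [Module ℚ G]
  [AddCommGroup H] [LinearOrder H] [IsOrderedAddMonoid H] [Module ℚ H]

variable (G) in
/-- The archimedean classes of nonzero elements are densely ordered. -/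
def HasDenseClasses : Prop :=
  ∀ x y : G, 0 < x → mk y < mk x → ∃ z, 0 < z ∧ mk y < mk z ∧ mk z < mk x

variable (G H) in
/-- Every ratio of two positive elements of the same archimedean class of `G` is, up to
infinitesimals, the ratio of an element of `H` to any given positive element of `H`. -/
def TransfersRatios : Prop :=
  ∀ (x y : G) (x' : H), 0 < x → 0 < y → mk x = mk y → 0 < x' → ∃ y' : H, 0 ≤ y' ∧
    ∀ m n : ℕ, (m • x < n • y → m • x' ≤ n • y') ∧ (n • y < m • x → n • y' ≤ m • x')

/-- The multiples of a positive element `x` are interleaved with the multiples of any element of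
its archimedean class. -/
theorem exists_nsmul_le_lt {x y : G} (hx : 0 < x) (hy : 0 ≤ y) (hxy : mk x ≤ mk y) :
    ∃ k : ℕ, k • x ≤ y ∧ y < (k + 1) • x := by
  rw [ArchimedeanClass.mk_le_mk] at hxy
  obtain ⟨n, hn⟩ := hxy
  rw [abs_of_pos hx, abs_of_nonneg hy] at hn
  have hex : ∃ k : ℕ, y < (k + 1) • x := ⟨n, hn.trans_lt (by
    rw [succ_nsmul]; exact lt_add_of_pos_right _ hx)⟩
  classical
  refine ⟨Nat.find hex, ?_, Nat.find_spec hex⟩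
  rcases Nat.eq_zero_or_pos (Nat.find hex) with h | h
  · simpa [h] using hy
  · have := Nat.find_min hex (Nat.sub_lt h one_pos)
    rwa [not_lt, Nat.sub_add_cancel (show 1 ≤ Nat.find hex from h)] at this

/-- A ratio realized over `x` in the class of `x` cuts the elements that it stays away from in the
same way as its image. -/
theorem IsPartialIso.cut_of_ratio {Γ : Submodule ℚ (G × H)} (hΓ : IsPartialIso Γ) {x y : G}
    {x' y' : H} (hx : 0 < x) (hy : 0 < y) (hxy : mk x = mk y) (hxx : (x, x') ∈ Γ) (hy' : 0 ≤ y')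
    (hr : ∀ m n : ℕ, (m • x < n • y → m • x' ≤ n • y') ∧ (n • y < m • x → n • y' ≤ m • x'))
    {a : G} {b : H} (hab : (a, b) ∈ Γ) (hbest : mk (y - a) ≤ mk y) :
    (a < y → b < y') ∧ (y < a → y' < b) := by
  have hx' : 0 < x' := (hΓ _ hxx).1 hx
  have hb := hbest.trans hxy.ge
  rw [ArchimedeanClass.mk_le_mk] at hb
  obtain ⟨n, hn⟩ := hb
  rw [abs_of_pos hx] at hn
  have hn0 : 0 < n := by
    rcases Nat.eq_zero_or_pos n with rfl | h
    · simp at hn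
      exact absurd hn hx.not_ge
    · exact h
  -- As `x ≤ n • |y - a|`, the elements `(4 * n) • a` and `(4 * n) • y` are at least `4 • x` apart.
  -- Replacing `(4 * n) • y` by a multiple of `x` and transferring the comparison costs at most two
  -- multiples of `x'`, so the factor 4 leaves a margin.
  obtain ⟨k, hk1, hk2⟩ := exists_nsmul_le_lt (x := x) (y := (4 * n) • y) hx
    (nsmul_nonneg hy.le _) (hxy.le.trans (by
      rw [ArchimedeanClass.mk_le_mk]; exact ⟨4 * n, by rw [abs_nsmul]⟩))
  have hmem : ∀ c d : ℕ, (c • a + d • x, c • b + d • x') ∈ Γ := fun c d =>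
    Γ.add_mem (nsmul_mem hab c) (nsmul_mem hxx d)
  have hmem' : ∀ d : ℕ, (d • x, d • x') ∈ Γ := fun d => nsmul_mem hxx d
  constructor
  · intro h
    rw [abs_of_pos (sub_pos.2 h)] at hn
    have h1 : (4 * n) • a + 4 • x ≤ (4 * n) • y := by
      have := nsmul_le_nsmul_right hn 4
      rw [smul_smul, nsmul_sub] at this
      rwa [← le_sub_iff_add_le']
    have h2 := (hΓ.lt_iff (hmem (4 * n) 4) (hmem' (k + 1))).1 (h1.trans_lt hk2)
    -- Only strict inequalities transfer, so the comparison is made with `k - 1` in place of `k`.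
    have h3 : k • x' ≤ (4 * n) • y' + x' := by
      rcases Nat.eq_zero_or_pos k with rfl | hk
      · rw [zero_nsmul]; exact add_nonneg (nsmul_nonneg hy' _) hx'.le
      · obtain ⟨j, rfl⟩ := Nat.exists_eq_add_of_le' hk
        have := (hr j (4 * n)).1 (lt_of_lt_of_le (by
          rw [succ_nsmul]; exact lt_add_of_pos_right _ hx) hk1)
        rw [succ_nsmul]
        exact add_le_add_left this _
    rw [succ_nsmul x' k] at h2
    have h4 : (4 * n) • b + 4 • x' < (4 * n) • y' + 2 • x' := by
      rw [two_nsmul, ← add_assoc]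
      exact h2.trans_le (add_le_add_left h3 _)
    have h5 : (4 * n) • b < (4 * n) • y' := by
      have h6 : 2 • x' ≤ 4 • x' := nsmul_le_nsmul_left hx'.le (by norm_num)
      by_contra! h7
      exact absurd h4 (not_lt.2 (add_le_add h7 h6))
    exact lt_of_nsmul_lt_nsmul_right _ h5
  · intro h
    rw [abs_of_neg (sub_neg.2 h), neg_sub] at hn
    have h1 : (4 * n) • y + 4 • x ≤ (4 * n) • a := by
      have := nsmul_le_nsmul_right hn 4
      rw [smul_smul, nsmul_sub] at this
      rwa [← le_sub_iff_add_le']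
    have h2 : (k + 4) • x ≤ (4 * n) • a :=
      le_trans (by rw [add_nsmul]; exact add_le_add_left hk1 _) h1
    have h3 := (hΓ.le_iff (hmem' (k + 4)) (nsmul_mem hab (4 * n))).1 h2
    have h4 := (hr (k + 1) (4 * n)).2 hk2
    have h5 : (k + 1) • x' < (k + 4) • x' := nsmul_lt_nsmul_left hx' (by omega)
    exact lt_of_nsmul_lt_nsmul_right _ (h4.trans_lt (h5.trans_le h3))

/-- An element of a new archimedean class is put into the corresponding gap. -/
theorem IsPartialIso.cut_of_gap {Γ : Submodule ℚ (G × H)} (hΓ : IsPartialIso Γ) {y : G} {z : H}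
    (hy : 0 < y) (hz : 0 < z) {a : G} {b : H} (hab : (a, b) ∈ Γ) (hne : mk a ≠ mk y)
    (hlo : mk y < mk a → mk z < mk b) (hhi : mk a < mk y → mk b < mk z) :
    (a < y → b < z) ∧ (y < a → z < b) := by
  have h0 : ((0 : G), (0 : H)) ∈ Γ := Γ.zero_mem
  rcases hne.lt_or_gt with h | h
  · have hb := hhi h
    rcases le_total 0 a with ha | ha
    · have hb0 := (hΓ.le_iff h0 hab).1 ha
      exact ⟨fun h' => absurd h' (lt_of_mk_lt_mk_of_nonneg h ha).not_gt,
        fun _ => lt_of_mk_lt_mk_of_nonneg hb hb0⟩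
    · have hb0 := (hΓ.le_iff hab h0).1 ha
      exact ⟨fun _ => lt_of_mk_lt_mk_of_nonpos hb hb0,
        fun h' => absurd h' (lt_of_mk_lt_mk_of_nonpos h ha).not_gt⟩
  · exact ⟨fun _ => lt_of_mk_lt_mk_of_nonneg (hlo h) hz.le,
      fun h' => absurd h' (lt_of_mk_lt_mk_of_nonneg h hy.le).not_gt⟩

/-- Since `W'` has no largest class, some element is infinitely larger than representatives of
finitely many classes. Adding the class of an element outside `W` to the finite set keeps `t`
outside the convex subspace `W`. -/
theorem exists_mem_mk_lt_of_finite {W W' : Submodule ℚ H} (hne : ∃ t ∈ W', t ∉ W)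
    (hmax : ∀ w ∈ W', ∃ t ∈ W', 0 < t ∧ mk t < mk w) {C : Set (ArchimedeanClass H)}
    (hC : C.Finite) (hCW : ∀ c ∈ C, ∃ b ∈ W', mk b = c) (hW : IsAbsConvex (W : Set H)) :
    ∃ t ∈ W', t ∉ W ∧ 0 < t ∧ ∀ c ∈ C, mk t < c := by
  obtain ⟨t₀, ht₀, ht₀W⟩ := hne
  have hC' : (insert (mk t₀) C).Finite := hC.insert _
  obtain ⟨c, hc, hmin⟩ := hC'.exists_minimal (Set.insert_nonempty _ _)
  have hmin' : ∀ d ∈ insert (mk t₀) C, c ≤ d := fun d hd => (le_total c d).elim id (hmin hd)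
  obtain ⟨b, hb, rfl⟩ : ∃ b ∈ W', mk b = c := by
    rcases hc with rfl | hc
    · exact ⟨t₀, ht₀, rfl⟩
    · exact hCW c hc
  obtain ⟨t, ht, ht0, htb⟩ := hmax b hb
  refine ⟨t, ht, fun htW => ?_, ht0, fun d hd => htb.trans_le (hmin' d (Or.inr hd))⟩
  exact absurd (htb.trans_le (hmin' _ (Or.inl rfl))) (hW.mk_lt_mk ht₀W htW).not_gt

/-- The image of the gap in which a new archimedean class lies is not empty. -/
theorem exists_mem_gap {Γ₀ Γ : Submodule ℚ (G × H)} (hle : Γ₀ ≤ Γ) (hΓ : IsPartialIso Γ)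
    (hV : IsAbsConvex (dom Γ₀ : Set G)) (hW : IsAbsConvex (ran Γ₀ : Set H))
    (hleast : ∀ t : H, 0 < t → t ∉ ran Γ₀ → ∃ z, 0 < z ∧ z ∉ ran Γ₀ ∧ mk t < mk z)
    (hfin : (mk '' {a : G | a ∈ dom Γ ∧ a ∉ dom Γ₀}).Finite)
    {W' : Submodule ℚ H} (hW' : IsAbsConvex (W' : Set H)) (hΓW' : ran Γ ≤ W')
    (hne : ∃ t ∈ W', t ∉ ran Γ₀) (hmax : ∀ w ∈ W', ∃ t ∈ W', 0 < t ∧ mk t < mk w)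
    (hdense : HasDenseClasses H) {y : G} (hy : y ∉ dom Γ) :
    ∃ z ∈ W', 0 < z ∧ ∀ a b, (a, b) ∈ Γ →
      (mk y < mk a → mk z < mk b) ∧ (mk a < mk y → mk b < mk z) := by
  have hmem_dom : ∀ {a b}, (a, b) ∈ Γ → a ∈ dom Γ := fun h => mem_dom.2 ⟨_, h⟩
  have hmem_W' : ∀ {a b}, (a, b) ∈ Γ → b ∈ W' := fun h => hΓW' (mem_ran.2 ⟨_, h⟩)
  have hyV : y ∉ dom Γ₀ := fun h => hy (dom_mono hle h)
  have hlow : ∀ {a b}, (a, b) ∈ Γ → a ∈ dom Γ₀ → b ∈ ran Γ₀ := fun {a b} h ha => by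
    obtain ⟨b', hb'⟩ := mem_dom.1 ha
    rw [(hΓ.eq_iff h (hle hb')).1 rfl]
    exact mem_ran.2 ⟨a, hb'⟩
  have hUfin : {c | c ∈ mk '' {a : G | a ∈ dom Γ ∧ a ∉ dom Γ₀} ∧ c < mk y}.Finite :=
    hfin.subset fun c hc => hc.1
  have hLfin : {c | c ∈ mk '' {a : G | a ∈ dom Γ ∧ a ∉ dom Γ₀} ∧ mk y < c}.Finite :=
    hfin.subset fun c hc => hc.1
  -- `t` marks the upper end of the gap: the image of the smallest class of the domain above `y`,
  -- or, if there is none, an element of `W'` infinitely larger than the whole range of `Γ`.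
  obtain ⟨t, htW', htW, ht0, ht1, ht2⟩ : ∃ t ∈ W', t ∉ ran Γ₀ ∧ 0 < t ∧
      (∀ a b, (a, b) ∈ Γ → mk a < mk y → mk b ≤ mk t) ∧
      (∀ a b, (a, b) ∈ Γ → mk y < mk a → mk t < mk b) := by
    by_cases hU : {c | c ∈ mk '' {a : G | a ∈ dom Γ ∧ a ∉ dom Γ₀} ∧ c < mk y}.Nonempty
    · obtain ⟨c, ⟨⟨a₀, ⟨ha₀, ha₀'⟩, rfl⟩, ha₀y⟩, hcmax⟩ := hUfin.exists_maximal hU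
      obtain ⟨b₀, hb₀⟩ := mem_dom.1 ha₀
      refine ⟨|b₀|, hW' (hmem_W' hb₀) (abs_abs b₀).le, fun h => ?_, ?_, ?_, ?_⟩
      · exact hΓ.notMem_ran hle hb₀ ha₀' (hW h (abs_abs b₀).ge)
      · rw [abs_pos]
        rintro rfl
        exact hΓ.notMem_ran hle hb₀ ha₀' (zero_mem _)
      · intro a b hab hay
        rw [mk_abs, ← hΓ.mk_le_mk_iff hab hb₀]
        by_contra! h
        have haV : a ∉ dom Γ₀ := fun haV => absurd hay (hV.mk_lt_mk hyV haV).not_gt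
        exact absurd (hcmax ⟨⟨a, ⟨hmem_dom hab, haV⟩, rfl⟩, hay⟩ h.le) h.not_ge
      · intro a b hab hay
        rw [mk_abs, ← hΓ.mk_lt_mk_iff hb₀ hab]
        exact ha₀y.trans hay
    · obtain ⟨t, htW', htW, ht0, htC⟩ := exists_mem_mk_lt_of_finite hne hmax
        (hΓ.finite_ran hle hfin) (by
          rintro _ ⟨b, ⟨hb, -⟩, rfl⟩
          exact ⟨b, hΓW' hb, rfl⟩) hW
      refine ⟨t, htW', htW, ht0, fun a b hab hay => ?_, fun a b hab _ => ?_⟩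
      · have haV : a ∉ dom Γ₀ := fun haV => absurd hay (hV.mk_lt_mk hyV haV).not_gt
        exact absurd ⟨mk a, ⟨a, ⟨hmem_dom hab, haV⟩, rfl⟩, hay⟩ hU
      · by_cases hb : b ∈ ran Γ₀
        · exact hW.mk_lt_mk htW hb
        · exact htC _ ⟨b, ⟨mem_ran.2 ⟨a, hab⟩, hb⟩, rfl⟩
  -- If some new class lies below `y`, take the largest one and use density between its image and
  -- `t`. Otherwise only `dom Γ₀` lies below, and `hleast` gives an element infinitely smaller than
  -- `t` but still outside `ran Γ₀`.
  obtain ⟨z, hz0, htz, hz⟩ : ∃ z : H, 0 < z ∧ mk t < mk z ∧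
      ∀ a b, (a, b) ∈ Γ → mk y < mk a → mk z < mk b := by
    by_cases hL : {c | c ∈ mk '' {a : G | a ∈ dom Γ ∧ a ∉ dom Γ₀} ∧ mk y < c}.Nonempty
    · obtain ⟨c, ⟨⟨a₀, ⟨ha₀, ha₀'⟩, rfl⟩, ha₀y⟩, hcmin⟩ := hLfin.exists_minimal hL
      obtain ⟨b₀, hb₀⟩ := mem_dom.1 ha₀
      have hb₀W := hΓ.notMem_ran hle hb₀ ha₀'
      obtain ⟨z, hz0, hz1, hz2⟩ := hdense |b₀| t (abs_pos.2 (by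
        rintro rfl; exact hb₀W (zero_mem _))) (by rw [mk_abs]; exact ht2 _ _ hb₀ ha₀y)
      rw [mk_abs] at hz2
      refine ⟨z, hz0, hz1, fun a b hab hay => hz2.trans_le ?_⟩
      by_cases haV : a ∈ dom Γ₀
      · exact (hW.mk_lt_mk hb₀W (hlow hab haV)).le
      · rw [← hΓ.mk_le_mk_iff hb₀ hab]
        exact (le_total _ _).elim id (hcmin ⟨⟨a, ⟨hmem_dom hab, haV⟩, rfl⟩, hay⟩)
    · obtain ⟨z, hz0, hzW, htz⟩ := hleast t ht0 htW
      refine ⟨z, hz0, htz, fun a b hab hay => ?_⟩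
      by_cases haV : a ∈ dom Γ₀
      · exact hW.mk_lt_mk hzW (hlow hab haV)
      · exact absurd ⟨mk a, ⟨a, ⟨hmem_dom hab, haV⟩, rfl⟩, hay⟩ hL
  refine ⟨z, hW' htW' ?_, hz0, fun a b hab => ⟨hz a b hab, fun hay =>
    (ht1 a b hab hay).trans_lt htz⟩⟩
  rw [abs_of_pos hz0, abs_of_pos ht0]
  exact (lt_of_mk_lt_mk_of_nonneg htz ht0.le).le

/-- A partial isomorphism that is a finite extension of a good one can be extended to one more
element, within given bounds. -/
theorem IsPartialIso.exists_extension {Γ₀ Γ : Submodule ℚ (G × H)} (hle : Γ₀ ≤ Γ)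
    (hΓ : IsPartialIso Γ)
    (hV : IsAbsConvex (dom Γ₀ : Set G)) (hW : IsAbsConvex (ran Γ₀ : Set H))
    (hleast : ∀ t : H, 0 < t → t ∉ ran Γ₀ → ∃ z, 0 < z ∧ z ∉ ran Γ₀ ∧ mk t < mk z)
    (hfin : (mk '' {a : G | a ∈ dom Γ ∧ a ∉ dom Γ₀}).Finite)
    {W' : Submodule ℚ H} (hW' : IsAbsConvex (W' : Set H)) (hΓW' : ran Γ ≤ W')
    (hne : ∃ t ∈ W', t ∉ ran Γ₀) (hmax : ∀ w ∈ W', ∃ t ∈ W', 0 < t ∧ mk t < mk w)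
    (hdense : HasDenseClasses H) (hratio : TransfersRatios G H) {y : G} (hy : y ∉ dom Γ) :
    ∃ y' ∈ W', IsPartialIso (Γ ⊔ Submodule.span ℚ {(y, y')}) ∧
      (mk '' {a : G | a ∈ dom (Γ ⊔ Submodule.span ℚ {(y, y')}) ∧ a ∉ dom Γ₀}).Finite := by
  -- No element of the domain comes closer to `y - u` than its own class, so it is enough to treat
  -- such elements: `key` handles them by a ratio when the class is old and by a gap when it is new.
  obtain ⟨u, hu, hbest⟩ := exists_best_approximation hV (dom_mono hle) hfin hy
  obtain ⟨u', huu⟩ := mem_dom.1 hu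
  have key : ∀ y : G, 0 < y → y ∉ dom Γ → (∀ u ∈ dom Γ, mk (y - u) ≤ mk y) →
      ∃ y' ∈ W', IsPartialIso (Γ ⊔ Submodule.span ℚ {(y, y')}) := by
    intro y hy0 hy hbest
    obtain ⟨y', hy', hcut⟩ : ∃ y' ∈ W', ∀ a b, (a, b) ∈ Γ →
        (a < y → b < y') ∧ (y < a → y' < b) := by
      by_cases hx : ∃ x ∈ dom Γ, mk x = mk y
      · obtain ⟨x, hx, hxy⟩ := hx
        obtain ⟨x', hxx⟩ := mem_dom.1 hx
        have hxx' := hΓ.abs_mem hxx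
        have hx0 : 0 < |x| := abs_pos.2 (by
          rintro rfl
          rw [mk_zero, eq_comm, mk_eq_top_iff] at hxy
          exact hy0.ne' hxy)
        rw [← mk_abs x] at hxy
        obtain ⟨y', hy', hr⟩ := hratio |x| y |x'| hx0 hy0 hxy ((hΓ _ hxx').1 hx0)
        refine ⟨y', ?_, fun a b hab => hΓ.cut_of_ratio hx0 hy0 hxy hxx' hy' hr hab
          (hbest a (mem_dom.2 ⟨b, hab⟩))⟩
        obtain ⟨k, -, hk⟩ := exists_nsmul_le_lt hx0 hy0.le hxy.le
        have h1 := (hr (k + 1) 1).2 (by rwa [one_nsmul])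
        rw [one_nsmul] at h1
        refine hW' (nsmul_mem (hΓW' (mem_ran.2 ⟨_, hxx'⟩)) (k + 1)) ?_
        rwa [abs_of_nonneg hy', abs_of_nonneg (nsmul_nonneg (abs_nonneg _) _)]
      · push Not at hx
        obtain ⟨z, hz, hz0, hgap⟩ := exists_mem_gap hle hΓ hV hW hleast hfin hW' hΓW' hne hmax
          hdense hy
        exact ⟨z, hz, fun a b hab => hΓ.cut_of_gap hy0 hz0 hab (hx a (mem_dom.2 ⟨b, hab⟩))
          (hgap a b hab).1 (hgap a b hab).2⟩
    exact ⟨y', hy', hΓ.sup_span (fun a b h => (hcut a b h).1) (fun a b h => (hcut a b h).2) hy⟩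
  have hyu : y - u ∉ dom Γ := fun h => hy (by simpa using add_mem h hu)
  have hyu0 : y - u ≠ 0 := fun h => hyu (h ▸ zero_mem _)
  -- At most one class is added, that of `y - u`: an element `c + q • y` with `q ≠ 0` either has
  -- this class or is infinitely larger, and then `c + q • u` in the old domain has the same class.
  have hfinite : ∀ y', (mk '' {a : G | a ∈ dom (Γ ⊔ Submodule.span ℚ {(y, y')}) ∧
      a ∉ dom Γ₀}).Finite := by
    intro y'
    refine (hfin.insert (mk (y - u))).subset ?_
    rintro _ ⟨a, ⟨ha, ha'⟩, rfl⟩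
    obtain ⟨b, hb⟩ := mem_dom.1 ha
    obtain ⟨⟨c, d⟩, hcd, w, hw, hsum⟩ := Submodule.mem_sup.1 hb
    obtain ⟨q, rfl⟩ := Submodule.mem_span_singleton.1 hw
    obtain ⟨rfl, -⟩ := Prod.mk.inj hsum
    by_cases hq : q = 0
    · subst hq
      right
      refine ⟨c, ⟨mem_dom.2 ⟨d, hcd⟩, fun h => ha' ?_⟩, by simp⟩
      simpa using h
    · have h1 : c + q • y = q • (y - -q⁻¹ • c) := by
        rw [smul_sub, smul_smul, mul_neg, mul_inv_cancel₀ hq, neg_smul, one_smul]; abel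
      have hcdom : c ∈ dom Γ := mem_dom.2 ⟨d, hcd⟩
      have h3 : mk (c + q • y) ≤ mk (y - u) := by
        rw [h1, mk_smul hq]
        exact hbest _ (Submodule.smul_mem _ _ hcdom)
      rcases h3.lt_or_eq with h3 | h3
      · right
        have h4 : mk ((c + q • y) - q • (y - u)) = mk (c + q • y) :=
          mk_sub_eq_mk_left (by rwa [mk_smul hq])
        have h5 : (c + q • y) - q • (y - u) = c + q • u := by rw [smul_sub]; abel
        rw [h5] at h4
        refine ⟨c + q • u, ⟨add_mem hcdom (Submodule.smul_mem _ _ hu), fun h => ha' ?_⟩, h4⟩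
        by_contra h7
        exact absurd (hV.mk_lt_mk h7 h) (not_lt.2 h4.le)
      · left
        exact h3
  -- The sign `ε = ±1` makes `ε • (y - u)` positive. Adjoining an image of it amounts to adjoining
  -- the corresponding image of `y`.
  have hspan : ∀ (ε : ℚ) (y' : H), ε * ε = 1 →
      Γ ⊔ Submodule.span ℚ {(y, ε • y' + u')} = Γ ⊔ Submodule.span ℚ {(ε • (y - u), y')} := by
    intro ε y' hε
    refine le_antisymm (sup_le le_sup_left ?_) (sup_le le_sup_left ?_) <;>
      rw [Submodule.span_singleton_le_iff_mem] <;> refine Submodule.mem_sup.2 ?_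
    · refine ⟨(u, u'), huu, ε • (ε • (y - u), y'), Submodule.smul_mem _ _
        (Submodule.mem_span_singleton_self _), ?_⟩
      ext
      · simp [smul_smul, hε]
      · simp [add_comm]
    · refine ⟨-ε • (u, u'), Γ.smul_mem _ huu, ε • (y, ε • y' + u'), Submodule.smul_mem _ _
        (Submodule.mem_span_singleton_self _), ?_⟩
      ext
      · simp [smul_sub]; abel
      · simp [smul_smul, hε]
  obtain ⟨ε, hε, hpos⟩ : ∃ ε : ℚ, ε * ε = 1 ∧ 0 < ε • (y - u) := by
    rcases hyu0.lt_or_gt with h | h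
    · exact ⟨-1, by norm_num, by rw [neg_smul, one_smul]; exact neg_pos.2 h⟩
    · exact ⟨1, by norm_num, by rwa [one_smul]⟩
  have hε0 : ε ≠ 0 := by rintro rfl; norm_num at hε
  obtain ⟨y', hy', hiso⟩ := key (ε • (y - u)) hpos
    (fun h => hyu (by simpa [smul_smul, hε] using Submodule.smul_mem _ ε h)) (fun w hw => by
      have h1 : ε • (y - u) - w = ε • (y - (u + ε • w)) := by
        rw [smul_sub, smul_sub, smul_add, smul_smul, hε, one_smul]; abel
      rw [h1, mk_smul hε0, mk_smul hε0]
      exact hbest _ (add_mem hu (Submodule.smul_mem _ _ hw)))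
  refine ⟨ε • y' + u', add_mem (Submodule.smul_mem _ _ hy') (hΓW' (mem_ran.2 ⟨_, huu⟩)), ?_,
    hfinite _⟩
  rwa [hspan ε y' hε]

end OrderedRatModule

/-! ### Good subspaces, the countable back-and-forth and the isomorphism theorem -/

namespace OrderedRatModule

section Good

variable {G : Type*} [AddCommGroup G] [LinearOrder G] [IsOrderedAddMonoid G] [Module ℚ G]

/-- A function that strictly decreases the archimedean classes of positive elements, but is
unbounded on every unbounded set. -/
def IsRegressive (h : G → G) : Prop :=
  (∀ x, 0 < x → 0 < h x ∧ mk x < mk (h x)) ∧ ∀ b, ∃ c, ∀ x, 0 < x → h x ≤ b → x ≤ c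

/-- A convex subspace closed under preimages of `h`. -/
def IsGood (h : G → G) (V : Submodule ℚ G) : Prop :=
  IsAbsConvex (V : Set G) ∧ ∀ x, 0 < x → h x ∈ V → x ∈ V

/-- This is the purpose of goodness: `h` maps the positive part of the complement of `V` into
itself, so no class there is least, and a gap just above `V` can always be filled. -/
theorem IsGood.exists_mk_lt {h : G → G} (hh : IsRegressive h) {V : Submodule ℚ G}
    (hV : IsGood h V) (t : G) (ht : 0 < t) (htV : t ∉ V) : ∃ z, 0 < z ∧ z ∉ V ∧ mk t < mk z :=
  ⟨h t, (hh.1 t ht).1, fun hz => htV (hV.2 t ht hz), (hh.1 t ht).2⟩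

variable [Uncountable G] (hG : ∀ b : G, {x : G | |x| ≤ b}.Countable)
include hG

/-- Otherwise `G` would be a countable union of countable intervals. -/
theorem exists_forall_abs_le {S : Set G} (hS : S.Countable) : ∃ c, ∀ s ∈ S, |s| ≤ c := by
  by_contra! h
  refine Set.not_countable_univ (α := G) ((hS.biUnion fun s _ => hG |s|).mono fun x _ => ?_)
  obtain ⟨s, hs, hlt⟩ := h |x|
  exact Set.mem_biUnion hs hlt.le

theorem countable_of_ne_top {V : Submodule ℚ G} (hV : IsAbsConvex (V : Set G)) (hne : V ≠ ⊤) :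
    (V : Set G).Countable := by
  obtain ⟨a, ha⟩ : ∃ a, a ∉ V := by
    by_contra! h
    exact hne (Submodule.eq_top_iff'.2 h)
  refine (hG |a|).mono fun x hx => ?_
  by_contra! h
  exact ha (hV hx (not_le.1 h).le)

/-- Every countable set is contained in a countable good subspace without a largest archimedean
class. -/
theorem exists_good_countable {h : G → G} (hh : IsRegressive h) {S : Set G} (hS : S.Countable) :
    ∃ V : Submodule ℚ G, IsGood h V ∧ (V : Set G).Countable ∧ S ⊆ V ∧
      ∀ w ∈ V, ∃ t ∈ V, 0 < t ∧ mk t < mk w := by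
  obtain ⟨p, hp⟩ : ∃ p : G, 0 < p := by
    obtain ⟨x, hx⟩ := exists_ne (0 : G)
    exact ⟨|x|, abs_pos.2 hx⟩
  -- `e` is infinitely larger than `b` and bounds the preimages under `h` of everything below `|b|`;
  -- the union of the intervals obtained by iterating it is then good, with no largest class.
  have hgrow : ∀ b : G, ∃ e, (∀ n : ℕ, n • |b| < e) ∧ ∀ x, 0 < x → h x ≤ |b| → x ≤ e := by
    intro b
    obtain ⟨c, hc⟩ := exists_forall_abs_le hG (Set.countable_range fun n : ℕ => n • |b| + p)
    obtain ⟨d, hd⟩ := hh.2 |b|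
    refine ⟨max c d, fun n => ?_, fun x hx hxb => (hd x hx hxb).trans (le_max_right _ _)⟩
    exact (lt_add_of_pos_right _ hp).trans_le
      ((le_abs_self _).trans ((hc _ ⟨n, rfl⟩).trans (le_max_left _ _)))
  choose e he1 he2 using hgrow
  have he0 : ∀ b, 0 < e b := fun b => by simpa using he1 b 0
  have hmk : ∀ b, mk (e b) < mk b := fun b => by
    rw [mk_lt_mk]
    intro n
    rw [abs_of_pos (he0 b)]
    exact he1 b n
  obtain ⟨b₀, hb₀⟩ := exists_forall_abs_le hG hS
  let B : ℕ → G := fun n => e^[n + 1] b₀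
  have hBs : ∀ n, B (n + 1) = e (B n) := fun n => Function.iterate_succ_apply' _ _ _
  have hB0 : ∀ n, 0 < B n := fun n => by
    simp only [B]
    rw [Function.iterate_succ_apply']
    exact he0 _
  have hBlt : ∀ n k : ℕ, k • B n < B (n + 1) := fun n k => by
    have := he1 (B n) k
    rwa [abs_of_pos (hB0 n), ← hBs] at this
  have hBmono : Monotone B := monotone_nat_of_le_succ fun n => by
    simpa using (hBlt n 1).le
  let V : Submodule ℚ G :=
    { carrier := {x | ∃ n, |x| ≤ B n}
      zero_mem' := ⟨0, by simpa using (hB0 0).le⟩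
      add_mem' := by
        rintro x y ⟨m, hm⟩ ⟨n, hn⟩
        refine ⟨max m n + 1, (abs_add_le x y).trans ?_⟩
        refine (add_le_add (hm.trans (hBmono (le_max_left m n)))
          (hn.trans (hBmono (le_max_right m n)))).trans ?_
        rw [← two_nsmul]
        exact (hBlt _ 2).le
      smul_mem' := by
        rintro q x ⟨m, hm⟩
        by_cases hq : q = 0
        · subst hq
          exact ⟨m, by simpa using (hB0 m).le⟩
        · have h1 := (mk_smul hq x).ge
          rw [mk_le_mk] at h1
          obtain ⟨k, hk⟩ := h1
          exact ⟨m + 1, hk.trans ((nsmul_le_nsmul_right hm k).trans (hBlt m k).le)⟩ }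
  have hmem : ∀ x, x ∈ V ↔ ∃ n, |x| ≤ B n := fun x => Iff.rfl
  refine ⟨V, ⟨fun a b ⟨n, hn⟩ hab => ⟨n, hab.trans hn⟩, fun x hx ⟨n, hn⟩ => ⟨n + 1, ?_⟩⟩, ?_, ?_, ?_⟩
  · rw [abs_of_pos hx, hBs]
    exact he2 _ x hx ((le_abs_self _).trans (hn.trans (le_abs_self _)))
  · refine (Set.countable_iUnion fun n => hG (B n)).mono ?_
    rintro x ⟨n, hn⟩
    exact Set.mem_iUnion.2 ⟨n, hn⟩
  · intro s hs
    refine ⟨0, (hb₀ s hs).trans ((le_abs_self _).trans ?_)⟩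
    change |b₀| ≤ e b₀
    simpa using (he1 b₀ 1).le
  · rintro w ⟨n, hn⟩
    refine ⟨B (n + 1), ⟨n + 1, (abs_of_pos (hB0 _)).le⟩, hB0 _, ?_⟩
    rw [hBs]
    refine (hmk _).trans_le (mk_le_mk_of_abs ?_)
    rwa [abs_of_pos (hB0 n)]

end Good

variable {G H : Type*} [AddCommGroup G] [LinearOrder G] [IsOrderedAddMonoid G] [Module ℚ G]
  [AddCommGroup H] [LinearOrder H] [IsOrderedAddMonoid H] [Module ℚ H]

/-- The partial isomorphisms used in the back-and-forth construction: those between subspaces of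
`V` and `W` that extend `Γ₀` and have only finitely many new archimedean classes. -/
structure IsFiniteExtension (Γ₀ : Submodule ℚ (G × H)) (V : Submodule ℚ G) (W : Submodule ℚ H)
    (Γ : Submodule ℚ (G × H)) : Prop where
  le : Γ₀ ≤ Γ
  isPartialIso : IsPartialIso Γ
  dom_le : dom Γ ≤ V
  ran_le : ran Γ ≤ W
  finite : (mk '' {a : G | a ∈ dom Γ ∧ a ∉ dom Γ₀}).Finite

theorem IsFiniteExtension.swap {Γ₀ Γ : Submodule ℚ (G × H)} {V : Submodule ℚ G}
    {W : Submodule ℚ H} (h : IsFiniteExtension Γ₀ V W Γ) :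
    IsFiniteExtension (swap Γ₀) W V (swap Γ) where
  le := swap_mono h.le
  isPartialIso := h.isPartialIso.swap
  dom_le := by rw [dom_swap]; exact h.ran_le
  ran_le := by rw [ran_swap]; exact h.dom_le
  finite := by
    rw [dom_swap, dom_swap]
    exact h.isPartialIso.finite_ran h.le h.finite

/-- The "forth" half of the back-and-forth; the "back" half is the same statement applied to `swap`.
-/
theorem IsFiniteExtension.exists_mem_dom {h : G → G} {k : H → H} (hk : IsRegressive k)
    (hdense : HasDenseClasses H) (hratio : TransfersRatios G H)
    {Γ₀ Γ : Submodule ℚ (G × H)} {V : Submodule ℚ G} {W : Submodule ℚ H}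
    (hΓ : IsFiniteExtension Γ₀ V W Γ) (hV₀ : IsGood h (dom Γ₀)) (hW₀ : IsGood k (ran Γ₀))
    (hW : IsGood k W) (hne : ∃ t ∈ W, t ∉ ran Γ₀)
    (hmax : ∀ w ∈ W, ∃ t ∈ W, 0 < t ∧ ArchimedeanClass.mk t < ArchimedeanClass.mk w) {v : G} (hv : v ∈ V) :
    ∃ Δ, IsFiniteExtension Γ₀ V W Δ ∧ v ∈ dom Δ ∧ Γ ≤ Δ := by
  by_cases hvΓ : v ∈ dom Γ
  · exact ⟨Γ, hΓ, hvΓ, le_rfl⟩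
  · obtain ⟨y', hy', hiso, hfin⟩ := hΓ.isPartialIso.exists_extension hΓ.le hV₀.1 hW₀.1
      (hW₀.exists_mk_lt hk) hΓ.finite hW.1 hΓ.ran_le hne hmax hdense hratio hvΓ
    refine ⟨_, ⟨hΓ.le.trans le_sup_left, hiso, ?_, ?_, hfin⟩, ?_, le_sup_left⟩
    · rw [dom, Submodule.map_sup]
      refine sup_le hΓ.dom_le ?_
      rw [Submodule.map_span, Set.image_singleton, Submodule.span_singleton_le_iff_mem]
      exact hv
    · rw [ran, Submodule.map_sup]
      refine sup_le hΓ.ran_le ?_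
      rw [Submodule.map_span, Set.image_singleton, Submodule.span_singleton_le_iff_mem]
      exact hy'
    · exact mem_dom.2 ⟨y', Submodule.mem_sup_right (Submodule.mem_span_singleton_self _)⟩

/-- The countable back-and-forth step. -/
theorem IsPartialIso.exists_extension_good {h : G → G} {k : H → H} (hh : IsRegressive h)
    (hk : IsRegressive k) (hdG : HasDenseClasses G) (hdH : HasDenseClasses H)
    (hGH : TransfersRatios G H) (hHG : TransfersRatios H G)
    {Γ₀ : Submodule ℚ (G × H)} (hΓ₀ : IsPartialIso Γ₀)
    (hV₀ : IsGood h (dom Γ₀)) (hW₀ : IsGood k (ran Γ₀))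
    {V : Submodule ℚ G} {W : Submodule ℚ H} (hV : IsGood h V) (hW : IsGood k W)
    (hVc : (V : Set G).Countable) (hWc : (W : Set H).Countable)
    (hV₀V : dom Γ₀ ≤ V) (hW₀W : ran Γ₀ ≤ W)
    (hneV : ∃ t ∈ V, t ∉ dom Γ₀) (hneW : ∃ t ∈ W, t ∉ ran Γ₀)
    (hmaxV : ∀ w ∈ V, ∃ t ∈ V, 0 < t ∧ mk t < mk w)
    (hmaxW : ∀ w ∈ W, ∃ t ∈ W, 0 < t ∧ mk t < mk w) :
    ∃ Γ, Γ₀ ≤ Γ ∧ IsPartialIso Γ ∧ dom Γ = V ∧ ran Γ = W := by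
  have hfin₀ : IsFiniteExtension Γ₀ V W Γ₀ := ⟨le_rfl, hΓ₀, hV₀V, hW₀W, by simp⟩
  have : Countable V := hVc.to_subtype
  have : Countable W := hWc.to_subtype
  have := Encodable.ofCountable V
  have := Encodable.ofCountable W
  let P := {Γ : Submodule ℚ (G × H) // IsFiniteExtension Γ₀ V W Γ}
  -- One cofinal set for each element of `V` and of `W`. An ideal meeting these countably many sets
  -- has a union with domain `V` and range `W`.
  let D : V ⊕ W → Order.Cofinal P := Sum.elim
    (fun v =>
      { carrier := {Γ | (v : G) ∈ dom Γ.1}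
        isCofinal := fun Γ => by
          obtain ⟨Δ, hΔ, hv, hle⟩ :=
            Γ.2.exists_mem_dom hk hdH hGH hV₀ hW₀ hW hneW hmaxW v.2
          exact ⟨⟨Δ, hΔ⟩, hv, hle⟩ })
    (fun w =>
      { carrier := {Γ | (w : H) ∈ ran Γ.1}
        isCofinal := fun Γ => by
          obtain ⟨Δ, hΔ, hw, hle⟩ := Γ.2.swap.exists_mem_dom hh hdG hHG
            (by rwa [dom_swap]) (by rwa [ran_swap]) hV (by rwa [ran_swap]) hmaxV w.2
          refine ⟨⟨OrderedRatModule.swap Δ, ?_⟩, ?_, ?_⟩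
          · have := hΔ.swap
            rwa [swap_swap] at this
          · rwa [← ran_swap] at hw
          · have := swap_mono hle
            rwa [swap_swap] at this })
  let I := Order.idealOfCofinals (⟨Γ₀, hfin₀⟩ : P) D
  have : Nonempty I := I.nonempty.to_subtype
  have hdir : Directed (· ≤ ·) fun Γ : I => (Γ : P).1 := by
    intro Γ Δ
    obtain ⟨E, hE, h1, h2⟩ := I.directed _ Γ.2 _ Δ.2
    exact ⟨⟨E, hE⟩, h1, h2⟩
  have hmem : ∀ z, z ∈ (⨆ Γ : I, (Γ : P).1) ↔ ∃ Γ : I, z ∈ (Γ : P).1 := fun z =>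
    Submodule.mem_iSup_of_directed _ hdir
  have hle : ∀ Γ : I, (Γ : P).1 ≤ ⨆ Γ : I, (Γ : P).1 := fun Γ => le_iSup (fun Γ : I => (Γ : P).1) Γ
  refine ⟨⨆ Γ : I, (Γ : P).1, ?_, ?_, le_antisymm ?_ ?_, le_antisymm ?_ ?_⟩
  · exact hle ⟨_, Order.mem_idealOfCofinals _ D⟩
  · intro z hz
    obtain ⟨Γ, hΓ⟩ := (hmem z).1 hz
    exact Γ.1.2.isPartialIso z hΓ
  · intro a ha
    obtain ⟨b, hb⟩ := mem_dom.1 ha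
    obtain ⟨Γ, hΓ⟩ := (hmem _).1 hb
    exact Γ.1.2.dom_le (mem_dom.2 ⟨b, hΓ⟩)
  · intro v hv
    obtain ⟨Γ, hΓ, hΓI⟩ := Order.cofinal_meets_idealOfCofinals (⟨Γ₀, hfin₀⟩ : P) D (Sum.inl ⟨v, hv⟩)
    exact dom_mono (hle ⟨Γ, hΓI⟩) hΓ
  · intro b hb
    obtain ⟨a, ha⟩ := mem_ran.1 hb
    obtain ⟨Γ, hΓ⟩ := (hmem _).1 ha
    exact Γ.1.2.ran_le (mem_ran.2 ⟨a, hΓ⟩)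
  · intro w hw
    obtain ⟨Γ, hΓ, hΓI⟩ := Order.cofinal_meets_idealOfCofinals (⟨Γ₀, hfin₀⟩ : P) D (Sum.inr ⟨w, hw⟩)
    exact ran_mono (hle ⟨Γ, hΓI⟩) hΓ

theorem IsPartialIso.countable_ran {Γ : Submodule ℚ (G × H)} (hΓ : IsPartialIso Γ)
    (hc : (dom Γ : Set G).Countable) : (ran Γ : Set H).Countable := by
  have hch : ∀ a : dom Γ, ∃ b, ((a : G), b) ∈ Γ := fun a => mem_dom.1 a.2
  choose f hf using hch
  have := hc.to_subtype
  refine (Set.countable_range f).mono fun b hb => ?_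
  obtain ⟨a, ha⟩ := mem_ran.1 hb
  have hd : a ∈ dom Γ := mem_dom.2 ⟨b, ha⟩
  exact ⟨⟨a, hd⟩, (hΓ.eq_iff (hf ⟨a, hd⟩) ha).1 rfl⟩

/-- A total and onto partial isomorphism is an isomorphism. -/
theorem IsPartialIso.nonempty_orderAddMonoidIso {Γ : Submodule ℚ (G × H)} (hΓ : IsPartialIso Γ)
    (hdom : dom Γ = ⊤) (hran : ran Γ = ⊤) : Nonempty (G ≃+o H) := by
  have h1 : ∀ a, ∃ b, (a, b) ∈ Γ := fun a => mem_dom.1 (hdom ▸ Submodule.mem_top)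
  have h2 : ∀ b, ∃ a, (a, b) ∈ Γ := fun b => mem_ran.1 (hran ▸ Submodule.mem_top)
  choose f hf using h1
  choose g hg using h2
  exact ⟨{
    toFun := f
    invFun := g
    left_inv := fun a => (hΓ.eq_iff (hg (f a)) (hf a)).2 rfl
    right_inv := fun b => (hΓ.eq_iff (hf (g b)) (hg b)).1 rfl
    map_add' := fun a b => (hΓ.eq_iff (hf (a + b)) (Γ.add_mem (hf a) (hf b))).1 rfl
    map_le_map_iff' := fun {a b} => (hΓ.le_iff (hf a) (hf b)).symm }⟩

/-- Two uncountable ordered `ℚ`-vector spaces with countable bounded intervals, densely ordered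
archimedean classes, regressive functions and the same ratios are isomorphic. -/
theorem nonempty_orderAddMonoidIso [Uncountable G] [Uncountable H]
    (hcG : ∀ b : G, {x : G | |x| ≤ b}.Countable) (hcH : ∀ b : H, {x : H | |x| ≤ b}.Countable)
    {h : G → G} {k : H → H} (hh : IsRegressive h) (hk : IsRegressive k)
    (hdG : HasDenseClasses G) (hdH : HasDenseClasses H)
    (hGH : TransfersRatios G H) (hHG : TransfersRatios H G) : Nonempty (G ≃+o H) := by
  -- Zorn's lemma replaces a recursion of length `ω₁`: partial isomorphisms with good domain and
  -- range are closed under unions of chains.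
  let Z : Set (Submodule ℚ (G × H)) :=
    {Γ | IsPartialIso Γ ∧ IsGood h (dom Γ) ∧ IsGood k (ran Γ)}
  have hbot : (⊥ : Submodule ℚ (G × H)) ∈ Z := by
    have hd : dom (⊥ : Submodule ℚ (G × H)) = ⊥ := Submodule.map_bot _
    have hr : ran (⊥ : Submodule ℚ (G × H)) = ⊥ := Submodule.map_bot _
    refine ⟨?_, ?_, ?_⟩
    · intro z hz
      rw [Submodule.mem_bot] at hz
      simp [hz]
    · rw [hd]
      refine ⟨fun a b hb hab => ?_, fun x hx hxV => ?_⟩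
      · have hb : b = 0 := by simpa using hb
        simpa [hb] using hab
      · exact absurd ((Submodule.mem_bot ℚ).1 hxV) (hh.1 x hx).1.ne'
    · rw [hr]
      refine ⟨fun a b hb hab => ?_, fun x hx hxV => ?_⟩
      · have hb : b = 0 := by simpa using hb
        simpa [hb] using hab
      · exact absurd ((Submodule.mem_bot ℚ).1 hxV) (hk.1 x hx).1.ne'
  obtain ⟨Γ, -, hmax⟩ := zorn_le_nonempty₀ Z (by
    intro c hcZ hc Γ₁ hΓ₁
    have hmem : ∀ z, z ∈ sSup c ↔ ∃ Γ ∈ c, z ∈ Γ := fun z =>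
      Submodule.mem_sSup_of_directed ⟨Γ₁, hΓ₁⟩ hc.directedOn
    refine ⟨sSup c, ⟨?_, ⟨?_, ?_⟩, ⟨?_, ?_⟩⟩, fun Γ hΓ => le_sSup hΓ⟩
    · intro z hz
      obtain ⟨Γ, hΓ, hzΓ⟩ := (hmem z).1 hz
      exact (hcZ hΓ).1 z hzΓ
    · intro a a' ha' hle
      obtain ⟨b, hb⟩ := mem_dom.1 ha'
      obtain ⟨Γ, hΓ, hbΓ⟩ := (hmem _).1 hb
      exact dom_mono (le_sSup hΓ) ((hcZ hΓ).2.1.1 (mem_dom.2 ⟨b, hbΓ⟩) hle)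
    · intro x hx ha'
      obtain ⟨b, hb⟩ := mem_dom.1 ha'
      obtain ⟨Γ, hΓ, hbΓ⟩ := (hmem _).1 hb
      exact dom_mono (le_sSup hΓ) ((hcZ hΓ).2.1.2 x hx (mem_dom.2 ⟨b, hbΓ⟩))
    · intro a a' ha' hle
      obtain ⟨b, hb⟩ := mem_ran.1 ha'
      obtain ⟨Γ, hΓ, hbΓ⟩ := (hmem _).1 hb
      exact ran_mono (le_sSup hΓ) ((hcZ hΓ).2.2.1 (mem_ran.2 ⟨b, hbΓ⟩) hle)
    · intro x hx ha'
      obtain ⟨b, hb⟩ := mem_ran.1 ha'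
      obtain ⟨Γ, hΓ, hbΓ⟩ := (hmem _).1 hb
      exact ran_mono (le_sSup hΓ) ((hcZ hΓ).2.2.2 x hx (mem_ran.2 ⟨b, hbΓ⟩))) ⊥ hbot
  obtain ⟨hiso, hV₀, hW₀⟩ := hmax.prop
  -- Were both countable, the back-and-forth step would extend `Γ`. As a proper convex subspace is
  -- countable and the partial isomorphism transports countability, this makes `Γ` total and onto.
  have hext : ¬ ((dom Γ : Set G).Countable ∧ (ran Γ : Set H).Countable) := by
    rintro ⟨hVc, hWc⟩
    obtain ⟨a, ha⟩ : ∃ a, a ∉ dom Γ := by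
      by_contra! hall
      exact Set.not_countable_univ (hVc.mono fun x _ => hall x)
    obtain ⟨b, hb⟩ : ∃ b, b ∉ ran Γ := by
      by_contra! hall
      exact Set.not_countable_univ (hWc.mono fun x _ => hall x)
    obtain ⟨V, hV, hVc', hVs, hVm⟩ := exists_good_countable hcG hh (hVc.insert a)
    obtain ⟨W, hW, hWc', hWs, hWm⟩ := exists_good_countable hcH hk (hWc.insert b)
    obtain ⟨Δ, hle, hΔ, hdom, hran⟩ := hiso.exists_extension_good hh hk hdG hdH hGH hHG hV₀ hW₀
      hV hW hVc' hWc' (fun x hx => hVs (Or.inr hx)) (fun x hx => hWs (Or.inr hx))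
      ⟨a, hVs (Or.inl rfl), ha⟩ ⟨b, hWs (Or.inl rfl), hb⟩ hVm hWm
    have := hmax.le_of_ge (y := Δ) ⟨hΔ, hdom ▸ hV, hran ▸ hW⟩ hle
    exact ha (dom_mono this (hdom ▸ hVs (Or.inl rfl)))
  refine hiso.nonempty_orderAddMonoidIso ?_ ?_
  · by_contra hne
    have hc := countable_of_ne_top hcG hV₀.1 hne
    exact hext ⟨hc, hiso.countable_ran hc⟩
  · by_contra hne
    have hc := countable_of_ne_top hcH hW₀.1 hne
    have := hiso.swap.countable_ran (by rwa [dom_swap])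
    rw [ran_swap] at this
    exact hext ⟨this, hc⟩

end OrderedRatModule

/-! ### Definability with parameters -/

open FirstOrder FirstOrder.Language

namespace PeanoModel

/-- A type of finite tuples of elements of `M`, with named coordinates. -/
class Context (M : Type*) (Γ : Type*) where
  /-- The names of the coordinates. -/
  Var : Type
  /-- The values of the coordinates. -/
  coord : Γ → Var → M

instance (M : Type*) : Context M M := ⟨Unit, fun x _ => x⟩

/-- Entering a quantifier appends a coordinate. `IsTerm.snd` under iterated `IsTerm.lift` then acts
as a de Bruijn index, and definability proofs follow the syntax of the formula. -/
instance (M Γ : Type*) [Context M Γ] : Context M (Γ × M) :=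
  ⟨Context.Var M Γ ⊕ Unit, fun z => Sum.elim (Context.coord z.1) fun _ => z.2⟩

section Definability

variable {M : Type*} [CommSemiring M] [LinearOrder M] {Γ : Type*} [Context M Γ]

/-- The function `f` is given by a term with parameters. -/
def IsTerm (f : Γ → M) : Prop :=
  ∃ (n : ℕ) (t : arithLang.Term (Fin n ⊕ Context.Var M Γ)) (p : Fin n → M),
    ∀ g, t.realize (Sum.elim p (Context.coord g)) = f g

variable (M) in
/-- The predicate `R` is definable with parameters in `M`. -/
def IsDef (R : Γ → Prop) : Prop :=
  ∃ (n : ℕ) (φ : arithLang.Formula (Fin n ⊕ Context.Var M Γ)) (p : Fin n → M),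
    ∀ g, φ.Realize (Sum.elim p (Context.coord g)) ↔ R g

namespace IsTerm

theorem const (c : M) : IsTerm fun _ : Γ => c :=
  ⟨1, Term.var (Sum.inl 0), fun _ => c, fun _ => rfl⟩

theorem self : IsTerm fun x : M => x :=
  ⟨0, Term.var (Sum.inr ()), Fin.elim0, fun _ => rfl⟩

theorem snd : IsTerm fun z : Γ × M => z.2 :=
  ⟨0, Term.var (Sum.inr (Sum.inr ())), Fin.elim0, fun _ => rfl⟩

theorem lift {f : Γ → M} (hf : IsTerm f) : IsTerm fun z : Γ × M => f z.1 := by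
  obtain ⟨n, t, p, ht⟩ := hf
  refine ⟨n, t.relabel (Sum.map id Sum.inl), p, fun z => ?_⟩
  rw [Term.realize_relabel]
  refine Eq.trans ?_ (ht z.1)
  congr 1
  ext i
  rcases i with i | i <;> rfl

theorem common {f h : Γ → M} (hf : IsTerm f) (hh : IsTerm h) :
    ∃ (n : ℕ) (s t : arithLang.Term (Fin n ⊕ Context.Var M Γ)) (p : Fin n → M),
      (∀ g, s.realize (Sum.elim p (Context.coord g)) = f g) ∧
      ∀ g, t.realize (Sum.elim p (Context.coord g)) = h g := by
  obtain ⟨n, s, p, hs⟩ := hf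
  obtain ⟨m, t, q, ht⟩ := hh
  refine ⟨n + m, s.relabel (Sum.map (Fin.castAdd m) id), t.relabel (Sum.map (Fin.natAdd n) id),
    Fin.append p q, fun g => ?_, fun g => ?_⟩
  · rw [Term.realize_relabel, ← hs]
    congr 1
    ext i
    rcases i with i | i <;> simp
  · rw [Term.realize_relabel, ← ht]
    congr 1
    ext i
    rcases i with i | i <;> simp

theorem add {f h : Γ → M} (hf : IsTerm f) (hh : IsTerm h) : IsTerm fun g => f g + h g := by
  obtain ⟨n, s, t, p, hs, ht⟩ := hf.common hh
  refine ⟨n, Term.func (L := arithLang) ArithFunc.add ![s, t], p, fun g => ?_⟩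
  exact congrArg₂ (· + ·) (hs g) (ht g)

theorem mul {f h : Γ → M} (hf : IsTerm f) (hh : IsTerm h) : IsTerm fun g => f g * h g := by
  obtain ⟨n, s, t, p, hs, ht⟩ := hf.common hh
  refine ⟨n, Term.func (L := arithLang) ArithFunc.mul ![s, t], p, fun g => ?_⟩
  exact congrArg₂ (· * ·) (hs g) (ht g)

theorem pow {f : Γ → M} (hf : IsTerm f) (n : ℕ) : IsTerm fun g => f g ^ n := by
  induction n with
  | zero => simpa using const 1
  | succ n ih => simpa only [pow_succ] using ih.mul hf

end IsTerm

namespace IsDef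

variable {R S : Γ → Prop}

theorem congr (hR : IsDef M R) (h : ∀ g, S g ↔ R g) : IsDef M S := by
  obtain ⟨n, φ, p, hφ⟩ := hR
  exact ⟨n, φ, p, fun g => (hφ g).trans (h g).symm⟩

theorem lt {f h : Γ → M} (hf : IsTerm f) (hh : IsTerm h) : IsDef M fun g => f g < h g := by
  obtain ⟨n, s, t, p, hs, ht⟩ := hf.common hh
  refine ⟨n, Relations.formula₂ (L := arithLang) ArithRel.lt s t, p, fun g => ?_⟩
  exact Formula.realize_rel₂.trans (iff_of_eq (congrArg₂ (· < ·) (hs g) (ht g)))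

theorem eq {f h : Γ → M} (hf : IsTerm f) (hh : IsTerm h) : IsDef M fun g => f g = h g := by
  obtain ⟨n, s, t, p, hs, ht⟩ := hf.common hh
  refine ⟨n, Term.equal s t, p, fun g => ?_⟩
  exact Formula.realize_equal.trans (iff_of_eq (congrArg₂ (· = ·) (hs g) (ht g)))

theorem not (hR : IsDef M R) : IsDef M fun g => ¬ R g := by
  obtain ⟨n, φ, p, hφ⟩ := hR
  exact ⟨n, φ.not, p, fun g => by rw [Formula.realize_not, hφ]⟩

theorem and (hR : IsDef M R) (hS : IsDef M S) : IsDef M fun g => R g ∧ S g := by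
  obtain ⟨n, φ, p, hφ⟩ := hR
  obtain ⟨m, ψ, q, hψ⟩ := hS
  refine ⟨n + m, φ.relabel (Sum.map (Fin.castAdd m) id) ⊓ ψ.relabel (Sum.map (Fin.natAdd n) id),
    Fin.append p q, fun g => ?_⟩
  rw [Formula.realize_inf, Formula.realize_relabel, Formula.realize_relabel]
  refine and_congr (Iff.trans (iff_of_eq ?_) (hφ g)) (Iff.trans (iff_of_eq ?_) (hψ g)) <;>
  · congr 1
    ext i
    rcases i with i | i <;> simp

theorem or (hR : IsDef M R) (hS : IsDef M S) : IsDef M fun g => R g ∨ S g :=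
  (hR.not.and hS.not).not.congr fun g => by tauto

theorem imp (hR : IsDef M R) (hS : IsDef M S) : IsDef M fun g => R g → S g :=
  (hR.and hS.not).not.congr fun g => by tauto

theorem iff (hR : IsDef M R) (hS : IsDef M S) : IsDef M fun g => R g ↔ S g :=
  ((hR.imp hS).and (hS.imp hR)).congr fun g => by tauto

theorem le {f h : Γ → M} (hf : IsTerm f) (hh : IsTerm h) : IsDef M fun g => f g ≤ h g :=
  (lt hh hf).not.congr fun g => by rw [not_lt]

theorem ex {R : Γ → M → Prop} (hR : IsDef M fun z : Γ × M => R z.1 z.2) :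
    IsDef M fun g => ∃ x, R g x := by
  obtain ⟨n, φ, p, hφ⟩ := hR
  refine ⟨n, Formula.iExs Unit (φ.relabel (β := (Fin n ⊕ Context.Var M Γ) ⊕ Unit)
    (Equiv.sumAssoc _ _ _).symm), p, fun g => ?_⟩
  rw [Formula.realize_iExs]
  have key : ∀ i : Unit → M, (φ.relabel (β := (Fin n ⊕ Context.Var M Γ) ⊕ Unit)
      (Equiv.sumAssoc _ _ _).symm).Realize (Sum.elim (Sum.elim p (Context.coord g)) i) ↔
      R g (i ()) := fun i => by
    rw [Formula.realize_relabel]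
    refine Iff.trans (iff_of_eq ?_) (hφ (g, i ()))
    congr 1
    ext j
    rcases j with j | j | j <;> rfl
  constructor
  · rintro ⟨i, hi⟩
    exact ⟨i (), (key i).1 hi⟩
  · rintro ⟨x, hx⟩
    exact ⟨fun _ => x, (key _).2 hx⟩

theorem all {R : Γ → M → Prop} (hR : IsDef M fun z : Γ × M => R z.1 z.2) :
    IsDef M fun g => ∀ x, R g x :=
  (ex (R := fun g x => ¬ R g x) hR.not).not.congr fun g => by simp

theorem dvd {f h : Γ → M} (hf : IsTerm f) (hh : IsTerm h) : IsDef M fun g => f g ∣ h g :=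
  (ex (R := fun g x => h g = f g * x) (eq hh.lift (hf.lift.mul .snd))).congr fun _ => Iff.rfl

/-- Substitution of terms in a binary definable predicate. -/
theorem subst₂ {D : M → M → Prop} (hD : IsDef M fun z : M × M => D z.1 z.2) {f h : Γ → M}
    (hf : IsTerm f) (hh : IsTerm h) : IsDef M fun g => D (f g) (h g) := by
  obtain ⟨n, φ, p, hφ⟩ := hD
  obtain ⟨m, s, t, q, hs, ht⟩ := hf.common hh
  refine ⟨n + m, BoundedFormula.subst φ (Sum.elim (fun i => Term.var (Sum.inl (Fin.castAdd m i)))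
    (Sum.elim (fun _ => s.relabel (Sum.map (Fin.natAdd n) id))
      fun _ => t.relabel (Sum.map (Fin.natAdd n) id))), Fin.append p q, fun g => ?_⟩
  rw [Formula.Realize, BoundedFormula.realize_subst]
  refine Iff.trans (iff_of_eq ?_) (hφ (f g, h g))
  rw [Formula.Realize]
  congr 1
  have key : ∀ t : arithLang.Term (Fin m ⊕ Context.Var M Γ),
      (t.relabel (Sum.map (Fin.natAdd n) id)).realize
        (Sum.elim (Fin.append p q) (Context.coord g)) =
      t.realize (Sum.elim q (Context.coord g)) := fun t => by
    rw [Term.realize_relabel]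
    congr 1
    ext i
    rcases i with i | i <;> simp
  ext i
  rcases i with i | i | i
  · simp
  · exact (key s).trans (hs g)
  · exact (key t).trans (ht g)

theorem snd {P : M → Prop} (hP : IsDef M P) : IsDef M fun z : Γ × M => P z.2 := by
  obtain ⟨n, φ, p, hφ⟩ := hP
  refine ⟨n, φ.relabel (Sum.map id Sum.inr), p, fun g => ?_⟩
  rw [Formula.realize_relabel]
  refine Iff.trans (iff_of_eq ?_) (hφ g.2)
  congr 1
  ext i
  rcases i with i | i <;> rfl

theorem subst₁ {P : M → Prop} (hP : IsDef M P) {f : Γ → M} (hf : IsTerm f) :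
    IsDef M fun g => P (f g) :=
  subst₂ (D := fun _ y => P y) hP.snd hf hf

end IsDef

end Definability

/-! ### Consequences of induction, primes and powers of two -/

section Arithmetic

variable {M : Type*} [CommSemiring M] [LinearOrder M] [IsPeanoModel M]

theorem induction {P : M → Prop} (hP : IsDef M P) (h0 : P 0) (hs : ∀ x, P x → P (x + 1)) (x : M) :
    P x := by
  obtain ⟨n, φ, p, hφ⟩ := hP
  have hφ' : ∀ x : M, φ.Realize (Sum.elim p fun _ => x) ↔ P x := hφ
  exact (hφ' x).1 (IsPeanoModel.induction n φ p ((hφ' 0).2 h0)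
    (fun x hx => (hφ' _).2 (hs x ((hφ' x).1 hx))) x)

theorem add_one_le_of_lt {a b : M} (h : a < b) : a + 1 ≤ b := by
  obtain ⟨c, rfl⟩ := exists_add_of_le h.le
  refine add_le_add_right (IsPeanoModel.one_le_of_pos c (pos_iff_ne_zero.2 ?_)) a
  rintro rfl
  simp at h

theorem lt_add_one_iff {a b : M} : a < b + 1 ↔ a ≤ b :=
  ⟨fun h => not_lt.1 fun h' => absurd (add_one_le_of_lt h') h.not_ge,
    fun h => h.trans_lt (lt_add_of_pos_right b one_pos)⟩

theorem exists_last {P : M → Prop} (hP : IsDef M P) (h0 : P 0) {b : M} (hb : ¬ P b) :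
    ∃ x, P x ∧ ¬ P (x + 1) := by
  by_contra! h
  exact hb (induction hP h0 h b)

/-- The downward closure of `P` is definable, contains `0` and misses `b + 1`, so it has a last
element. -/
theorem exists_greatest {P : M → Prop} (hP : IsDef M P) {a b : M} (ha : P a)
    (hb : ∀ x, P x → x ≤ b) : ∃ m, P m ∧ ∀ x, P x → x ≤ m := by
  obtain ⟨x, ⟨y, hy, hxy⟩, hx⟩ := exists_last (P := fun x => ∃ y, P y ∧ x ≤ y)
    (.ex (.and hP.snd (.le (IsTerm.lift .self) .snd)))
    ⟨a, ha, zero_le⟩ (b := b + 1)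
    (fun ⟨y, hy, hby⟩ => absurd (lt_add_one_iff.2 (hb y hy)) hby.not_gt)
  push Not at hx
  refine ⟨y, hy, fun z hz => ?_⟩
  exact (lt_add_one_iff.1 (hx z hz)).trans hxy

end Arithmetic

end PeanoModel

namespace PeanoModel

variable {M : Type*} [CommSemiring M] [LinearOrder M] [IsPeanoModel M]

theorem exists_least {P : M → Prop} (hP : IsDef M P) {a : M} (ha : P a) :
    ∃ m, P m ∧ ∀ x, P x → m ≤ x := by
  obtain ⟨x, hx, hx'⟩ := exists_last (P := fun x => ∀ y, P y → x ≤ y)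
    (.all (.imp hP.snd (.le (IsTerm.lift .self) .snd))) (fun _ _ => zero_le) (b := a + 1)
    (fun h => (lt_add_one_iff.2 le_rfl).not_ge (h a ha))
  push Not at hx'
  obtain ⟨y, hy, hyx⟩ := hx'
  refine ⟨y, hy, fun z hz => ?_⟩
  exact (lt_add_one_iff.1 hyx).trans (hx z hz)

theorem strong_induction {P : M → Prop} (hP : IsDef M P) (h : ∀ x, (∀ y, y < x → P y) → P x)
    (x : M) : P x := by
  by_contra hx
  obtain ⟨m, hm, hmin⟩ := exists_least hP.not hx
  exact hm (h m fun y hy => by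
    by_contra hy'
    exact absurd (hmin y hy') hy.not_ge)

/-- The elements larger than all standard natural numbers. -/
def IsNonstandard (x : M) : Prop := ∀ n : ℕ, (n : M) < x

theorem IsNonstandard.mono {x y : M} (hx : IsNonstandard x) (hxy : x ≤ y) : IsNonstandard y :=
  fun n => (hx n).trans_le hxy

theorem IsNonstandard.pos {x : M} (hx : IsNonstandard x) : 0 < x := by simpa using hx 0

theorem IsNonstandard.one_lt {x : M} (hx : IsNonstandard x) : 1 < x := by simpa using hx 1

theorem exists_natCast_of_le {x : M} {n : ℕ} (h : x ≤ n) : ∃ k : ℕ, k ≤ n ∧ x = k := by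
  induction n with
  | zero => exact ⟨0, le_rfl, le_antisymm h (by simp)⟩
  | succ n ih =>
    rcases h.lt_or_eq with h | h
    · rw [Nat.cast_succ, lt_add_one_iff] at h
      obtain ⟨k, hk, hx⟩ := ih h
      exact ⟨k, hk.trans n.le_succ, hx⟩
    · exact ⟨n + 1, le_rfl, h⟩

theorem exists_natCast_of_not_isNonstandard {x : M} (h : ¬ IsNonstandard x) : ∃ k : ℕ, x = k := by
  simp only [IsNonstandard, not_forall, not_lt] at h
  obtain ⟨n, hn⟩ := h
  obtain ⟨k, -, hk⟩ := exists_natCast_of_le hn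
  exact ⟨k, hk⟩

/-- A definable set containing all standard numbers contains a nonstandard one. -/
theorem overspill {P : M → Prop} (hP : IsDef M P) (h : ∀ n : ℕ, P n)
    {e : M} (he : IsNonstandard e) : ∃ k, IsNonstandard k ∧ P k := by
  by_contra! hn
  refine hn e he (induction hP (by simpa using h 0) (fun x hx => ?_) e)
  obtain ⟨k, rfl⟩ := exists_natCast_of_not_isNonstandard fun h' => hn x h' hx
  simpa using h (k + 1)

theorem exists_eq_mul_add (a : M) {b : M} (hb : 0 < b) : ∃ q r, a = b * q + r ∧ r < b := by
  refine induction (P := fun a => ∃ q r, a = b * q + r ∧ r < b) ?_ ?_ ?_ a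
  · exact .ex (.ex (.and (.eq (IsTerm.lift (IsTerm.lift .self))
      (.add (.mul (.const b) (IsTerm.lift .snd)) .snd)) (.lt .snd (.const b))))
  · exact ⟨0, 0, by simp, hb⟩
  · rintro x ⟨q, r, rfl, hr⟩
    rcases (add_one_le_of_lt hr).lt_or_eq with h | h
    · exact ⟨q, r + 1, by ring, h⟩
    · exact ⟨q + 1, 0, by rw [mul_add, mul_one, add_assoc, h, add_zero], hb⟩

theorem eq_one_of_mul_eq_one {a b : M} (h : a * b = 1) : a = 1 := by
  have ha : a ≠ 0 := by rintro rfl; simp at h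
  have hb : b ≠ 0 := by rintro rfl; simp at h
  have ha' := IsPeanoModel.one_le_of_pos a (pos_iff_ne_zero.2 ha)
  have hb' := IsPeanoModel.one_le_of_pos b (pos_iff_ne_zero.2 hb)
  refine le_antisymm ?_ ha'
  rw [← h]
  exact le_mul_of_one_le_right zero_le hb'

theorem le_of_dvd {a b : M} (hb : b ≠ 0) (h : a ∣ b) : a ≤ b := by
  obtain ⟨c, rfl⟩ := h
  have hc : c ≠ 0 := by rintro rfl; simp at hb
  exact le_mul_of_one_le_right zero_le
    (IsPeanoModel.one_le_of_pos c (pos_iff_ne_zero.2 hc))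

theorem mul_left_cancel_of_ne {a b c : M} (ha : a ≠ 0) (h : a * b = a * c) : b = c := by
  have ha' := pos_iff_ne_zero.2 ha
  exact le_antisymm (le_of_mul_le_mul_left h.le ha') (le_of_mul_le_mul_left h.ge ha')

theorem natCast_dvd_natCast {m n : ℕ} (hn : n ≠ 0) : (m : M) ∣ (n : M) ↔ m ∣ n := by
  constructor
  · rintro ⟨c, hc⟩
    have hcn : c ≤ (n : M) := le_of_dvd (by exact_mod_cast hn) ⟨m, by rw [hc, mul_comm]⟩
    obtain ⟨k, -, rfl⟩ := exists_natCast_of_le hcn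
    exact ⟨k, by exact_mod_cast hc⟩
  · exact Nat.cast_dvd_cast

/-- Remainders modulo the standard number `p` are standard, so divisibility of a product reduces to
divisibility in `ℕ`. -/
theorem prime_natCast {p : ℕ} (hp : p.Prime) : Prime (p : M) := by
  refine ⟨by exact_mod_cast hp.ne_zero, fun h => ?_, fun a b hab => ?_⟩
  · obtain ⟨b, hb⟩ := isUnit_iff_exists_inv.1 h
    exact hp.ne_one (by exact_mod_cast eq_one_of_mul_eq_one hb)
  · have hp0 : (0 : M) < p := by exact_mod_cast hp.pos
    obtain ⟨q, r, rfl, hr⟩ := exists_eq_mul_add a hp0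
    obtain ⟨q', r', rfl, hr'⟩ := exists_eq_mul_add b hp0
    obtain ⟨i, -, rfl⟩ := exists_natCast_of_le hr.le
    obtain ⟨j, -, rfl⟩ := exists_natCast_of_le hr'.le
    have h1 : (p * q + i) * (p * q' + j) = p * (q * (p * q' + j) + i * q') + i * j := by ring
    rw [h1] at hab
    obtain ⟨c, hc⟩ := hab
    have h2 : q * (p * q' + j) + i * q' ≤ c := by
      by_contra! h
      have := mul_lt_mul_of_pos_left h hp0
      rw [← hc] at this
      exact absurd (le_add_of_nonneg_right zero_le) this.not_ge
    obtain ⟨d, rfl⟩ := exists_add_of_le h2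
    rw [mul_add (p : M) _ d, add_right_inj] at hc
    have h3 : p ∣ i ∨ p ∣ j := by
      rcases Nat.eq_zero_or_pos (i * j) with h | h
      · rcases Nat.mul_eq_zero.1 h with rfl | rfl
        · exact Or.inl (dvd_zero _)
        · exact Or.inr (dvd_zero _)
      · refine hp.dvd_mul.1 ((natCast_dvd_natCast (M := M) h.ne').1 ⟨d, ?_⟩)
        rw [Nat.cast_mul]; exact hc
    refine h3.imp (fun h => ?_) fun h => ?_
    · exact dvd_add (dvd_mul_right _ _) (Nat.cast_dvd_cast h)
    · exact dvd_add (dvd_mul_right _ _) (Nat.cast_dvd_cast h)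

theorem nat_prime_of_prime {p : ℕ} (hp : Prime (p : M)) : p.Prime := by
  have hp0 : p ≠ 0 := by rintro rfl; exact hp.ne_zero (by simp)
  have hp1 : p ≠ 1 := by rintro rfl; exact hp.not_isUnit (by simp)
  refine Nat.prime_iff.2 ⟨hp0, by simpa using hp1, fun a b hab => ?_⟩
  rcases Nat.eq_zero_or_pos a with rfl | ha
  · exact Or.inl (dvd_zero _)
  rcases Nat.eq_zero_or_pos b with rfl | hb
  · exact Or.inr (dvd_zero _)
  have h : (p : M) ∣ (a : M) * b := by exact_mod_cast Nat.cast_dvd_cast (α := M) hab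
  exact (hp.dvd_or_dvd h).imp (natCast_dvd_natCast ha.ne').1 (natCast_dvd_natCast hb.ne').1

theorem prime_two : Prime (2 : M) := by
  simpa using prime_natCast (M := M) Nat.prime_two

theorem IsDef.prime {Γ : Type*} [Context M Γ] {f : Γ → M} (hf : IsTerm f) :
    IsDef M fun g => Prime (f g) := by
  have h : IsDef M fun x : M => Prime x := by
    refine (IsDef.and (IsDef.eq .self (.const 0)).not (IsDef.and (IsDef.not
      (IsDef.ex (R := fun x y => x * y = 1) (.eq (.mul (IsTerm.lift .self) .snd) (.const 1))))
      (.all (R := fun x a => ∀ b, x ∣ a * b → x ∣ a ∨ x ∣ b)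
        (.all (.imp (.dvd (IsTerm.lift (IsTerm.lift .self)) (.mul (IsTerm.lift .snd) .snd))
        (.or (.dvd (IsTerm.lift (IsTerm.lift .self)) (IsTerm.lift .snd))
          (.dvd (IsTerm.lift (IsTerm.lift .self)) .snd))))))).congr fun x => ?_
    rw [Prime, isUnit_iff_exists_inv]
  exact h.subst₁ hf

theorem eq_of_prime_dvd_prime {p q : M} (hp : Prime p) (hq : Prime q) (h : p ∣ q) : p = q := by
  obtain ⟨c, rfl⟩ := h
  rcases hq.dvd_or_dvd dvd_rfl with h | h
  · obtain ⟨d, hd⟩ := h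
    have : c * d = 1 := by
      refine mul_left_cancel_of_ne hp.ne_zero ?_
      rw [← mul_assoc, ← hd, mul_one]
    rw [eq_one_of_mul_eq_one this, mul_one]
  · have hc : c ≠ 0 := fun h => hq.ne_zero (by simp [h])
    obtain ⟨d, hd⟩ := h
    have h1 : p * d = 1 := by
      refine mul_left_cancel_of_ne hc ?_
      rw [mul_one, ← mul_assoc, mul_comm c p, ← hd]
    exact absurd (isUnit_iff_exists_inv.2 ⟨d, h1⟩) hp.not_isUnit

/-! ### Powers of two -/

/-- Powers of two, with a possibly nonstandard exponent. -/
def IsPowTwo (z : M) : Prop := z ≠ 0 ∧ ∀ d, d ∣ z → d = 1 ∨ 2 ∣ d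

theorem IsDef.isPowTwo {Γ : Type*} [Context M Γ] {f : Γ → M} (hf : IsTerm f) :
    IsDef M fun g => IsPowTwo (f g) :=
  .and (IsDef.eq hf (.const 0)).not (.all (.imp (.dvd .snd hf.lift)
    (.or (.eq .snd (.const 1)) (.dvd (.const 2) .snd))))

namespace IsPowTwo

variable {z w : M}

theorem pos (hz : IsPowTwo z) : 0 < z := pos_iff_ne_zero.2 hz.1

theorem one_le (hz : IsPowTwo z) : 1 ≤ z := IsPeanoModel.one_le_of_pos z hz.pos

theorem one : IsPowTwo (1 : M) :=
  ⟨one_ne_zero, fun _ ⟨_, hc⟩ => Or.inl (eq_one_of_mul_eq_one hc.symm)⟩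

theorem of_dvd (hz : IsPowTwo z) (h : w ∣ z) : IsPowTwo w :=
  ⟨fun h0 => hz.1 (by rwa [h0, zero_dvd_iff] at h), fun d hd => hz.2 d (hd.trans h)⟩

theorem two_mul (hz : IsPowTwo z) : IsPowTwo (2 * z) := by
  refine ⟨mul_ne_zero two_ne_zero hz.1, fun d hd => ?_⟩
  by_cases h2 : (2 : M) ∣ d
  · exact Or.inr h2
  · obtain ⟨c, hc⟩ := hd
    have : (2 : M) ∣ d * c := ⟨z, hc.symm⟩
    obtain ⟨c', rfl⟩ := (prime_two.dvd_or_dvd this).resolve_left h2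
    refine hz.2 d ⟨c', mul_left_cancel_of_ne two_ne_zero ?_⟩
    rw [hc]; ring

theorem exists_eq_two_mul (hz : IsPowTwo z) (h1 : z ≠ 1) : ∃ w, IsPowTwo w ∧ z = 2 * w := by
  obtain ⟨w, rfl⟩ := (hz.2 z dvd_rfl).resolve_left h1
  exact ⟨w, hz.of_dvd (dvd_mul_left _ _), rfl⟩

theorem lt_two_mul (hz : IsPowTwo z) : z < 2 * z := by
  rw [_root_.two_mul]
  exact lt_add_of_pos_right z hz.pos

theorem dvd_of_le (hz : IsPowTwo z) (hw : IsPowTwo w) (h : z ≤ w) : z ∣ w := by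
  revert w
  revert hz
  refine strong_induction (P := fun z => IsPowTwo z → ∀ w, IsPowTwo w → z ≤ w → z ∣ w) ?_ ?_ z
  · exact .imp (.isPowTwo .self) (.all (.imp (.isPowTwo .snd) (.imp (.le (IsTerm.lift .self) .snd)
      (.dvd (IsTerm.lift .self) .snd))))
  · intro z ih hz w hw hzw
    by_cases h1 : z = 1
    · exact h1 ▸ one_dvd w
    · obtain ⟨z', hz', rfl⟩ := hz.exists_eq_two_mul h1
      have hw1 : w ≠ 1 := by
        rintro rfl
        exact h1 (le_antisymm hzw hz.one_le)
      obtain ⟨w', hw', rfl⟩ := hw.exists_eq_two_mul hw1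
      exact mul_dvd_mul_left 2 (ih z' hz'.lt_two_mul hz' w' hw'
        (le_of_mul_le_mul_left hzw two_pos))

theorem mul (hz : IsPowTwo z) (hw : IsPowTwo w) : IsPowTwo (z * w) := by
  revert hz
  refine strong_induction (P := fun z => IsPowTwo z → IsPowTwo (z * w)) ?_ ?_ z
  · exact .imp (.isPowTwo .self) (.isPowTwo (.mul .self (.const w)))
  · intro z ih hz
    by_cases h1 : z = 1
    · rwa [h1, one_mul]
    · obtain ⟨z', hz', rfl⟩ := hz.exists_eq_two_mul h1
      rw [mul_assoc]
      exact (ih z' hz'.lt_two_mul hz').two_mul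

theorem pow (hz : IsPowTwo z) (n : ℕ) : IsPowTwo (z ^ n) := by
  induction n with
  | zero => rw [pow_zero]; exact one
  | succ n ih => rw [pow_succ]; exact ih.mul hz

end IsPowTwo

/-- Modulo finite factors, only powers of two matter. -/
theorem exists_isPowTwo_le_lt {a : M} (ha : a ≠ 0) : ∃ z, IsPowTwo z ∧ z ≤ a ∧ a < 2 * z := by
  have key : ∀ a : M, ∃ z, IsPowTwo z ∧ z ≤ a + 1 ∧ a + 1 < 2 * z := by
    refine induction ?_ ?_ ?_
    · exact .ex (.and (.isPowTwo .snd) (.and (.le .snd (.add (IsTerm.lift .self) (.const 1)))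
        (.lt (.add (IsTerm.lift .self) (.const 1)) (.mul (.const 2) .snd))))
    · exact ⟨1, .one, by simp, by simp⟩
    · rintro x ⟨z, hz, h1, h2⟩
      rcases (add_one_le_of_lt h2).lt_or_eq with h | h
      · exact ⟨z, hz, h1.trans (le_add_of_nonneg_right zero_le), h⟩
      · exact ⟨2 * z, hz.two_mul, h.ge, h ▸ hz.two_mul.lt_two_mul⟩
  obtain ⟨b, rfl⟩ := exists_add_of_le (IsPeanoModel.one_le_of_pos a (pos_iff_ne_zero.2 ha))
  rw [add_comm 1 b]
  exact key b

/-- Take the largest power of two whose `n`-th power is at most `z`. The error factor is below `2 ^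
n`, which the valuation ignores: this is the source of divisibility. -/
theorem IsPowTwo.exists_root {z : M} (hz : IsPowTwo z) {n : ℕ} (hn : n ≠ 0) :
    ∃ w, IsPowTwo w ∧ w ^ n ≤ z ∧ z < (2 * w) ^ n := by
  obtain ⟨w, ⟨hw, hwz⟩, hmax⟩ := exists_greatest (P := fun w : M => IsPowTwo w ∧ w ^ n ≤ z)
    (.and (.isPowTwo .self) (.le (IsTerm.pow .self n) (.const z))) (a := 1) (b := z)
    ⟨.one, by simpa using hz.one_le⟩ (fun w ⟨hw, hwz⟩ => (le_self_pow₀ hw.one_le hn).trans hwz)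
  refine ⟨w, hw, hwz, ?_⟩
  by_contra! h
  exact absurd (hmax _ ⟨hw.two_mul, h⟩) hw.lt_two_mul.not_ge

end PeanoModel

/-! ### Definable powers with standard exponents, slow growth and interpolation -/

namespace PeanoModel

variable {M : Type*} [CommSemiring M] [LinearOrder M] [IsPeanoModel M]

/-- The binomial expansion modulo `e²`: the exponent can be read off as the coefficient of `e`. -/
theorem exists_succ_pow_eq (e : M) (m : ℕ) : ∃ t, (e + 1) ^ m = 1 + m * e + e * e * t := by
  induction m with
  | zero => exact ⟨0, by simp⟩
  | succ m ih =>
    obtain ⟨t, ht⟩ := ih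
    refine ⟨m + e * t + t, ?_⟩
    rw [pow_succ, ht]
    push_cast
    ring

/-- A power of two congruent to `1` modulo `e`, where `e + 1` is a power of two, is a power of
`e + 1`. -/
theorem IsPowTwo.eq_pow_of_modEq {e : M} (he : IsPowTwo (e + 1)) (he0 : e ≠ 0) (m : ℕ) :
    ∀ {w : M} (_ : IsPowTwo w) (s : M) (_ : w = 1 + e * s) (_ : w ≤ (e + 1) ^ m),
      ∃ j ≤ m, w = (e + 1) ^ j := by
  induction m with
  | zero =>
    intro w hw s hs h
    exact ⟨0, le_rfl, le_antisymm h (by simpa using hw.one_le)⟩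
  | succ m ih =>
    intro w hw s hs h
    rcases lt_or_ge w (e + 1) with hlt | hge
    · refine ⟨0, Nat.zero_le _, ?_⟩
      have hs0 : s = 0 := by
        by_contra hs0
        have h1 : e ≤ e * s := le_mul_of_one_le_right zero_le
          (IsPeanoModel.one_le_of_pos s (pos_iff_ne_zero.2 hs0))
        refine absurd hlt (not_lt.2 ?_)
        rw [hs, add_comm]
        exact add_le_add_right h1 1
      rw [hs, hs0, mul_zero, add_zero, pow_zero]
    -- Dividing by `e + 1`, which is `1` modulo `e`, leaves a power of two still congruent to `1`
    -- modulo `e`.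
    · obtain ⟨v, rfl⟩ := he.dvd_of_le hw hge
      have hv : IsPowTwo v := hw.of_dvd (dvd_mul_left _ _)
      obtain ⟨x, rfl⟩ := exists_add_of_le hv.one_le
      have h1 : e * (1 + x) + x = e * s := by
        have : 1 + (e * (1 + x) + x) = 1 + e * s := by rw [← hs]; ring
        exact add_left_cancel this
      have h2 : 1 + x ≤ s := le_of_mul_le_mul_left (h1 ▸ le_add_of_nonneg_right zero_le)
        (pos_iff_ne_zero.2 he0)
      obtain ⟨c, rfl⟩ := exists_add_of_le h2
      rw [mul_add e (1 + x) c] at h1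
      have h3 : x = e * c := add_left_cancel h1
      obtain ⟨j, hj, hj'⟩ := ih hv c (by rw [h3]) (by
        rw [pow_succ'] at h
        exact le_of_mul_le_mul_left h he.pos)
      exact ⟨j + 1, by omega, by rw [hj', pow_succ']⟩

/-- Standard coefficients are smaller than the nonstandard `e`, so they are unique as digits. -/
theorem natCast_eq_of_modEq {e : M} (he : IsNonstandard e) {j m : ℕ} {s t : M}
    (h : 1 + j * e + e * e * s = 1 + m * e + e * e * t) : j = m := by
  have key : ∀ {j m : ℕ} {s t : M}, 1 + j * e + e * e * s = 1 + m * e + e * e * t → t ≤ s := by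
    intro j m s t h
    by_contra! hst
    obtain ⟨c, rfl⟩ := exists_add_of_le (add_one_le_of_lt hst)
    have h1 : (j : M) * e < 1 + (m * e + e * e * (1 + c)) := by
      rw [add_comm, lt_add_one_iff]
      have h2 : (1 + e * e * s) + j * e = (1 + e * e * s) + (m * e + e * e * (1 + c)) := by
        calc _ = 1 + j * e + e * e * s := by ring
          _ = _ := by rw [h]; ring
      exact (add_left_cancel h2).le
    have h3 : e * j = e * (m + e * (1 + c)) := by
      have h2 : (1 + e * e * s) + e * j = (1 + e * e * s) + e * (m + e * (1 + c)) := by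
        calc _ = 1 + j * e + e * e * s := by ring
          _ = _ := by rw [h]; ring
      exact add_left_cancel h2
    have h4 := mul_left_cancel_of_ne he.pos.ne' h3
    have h5 : e ≤ j := by
      rw [h4, mul_add, mul_one, add_left_comm]
      exact le_add_of_nonneg_right zero_le
    exact absurd h5 (he j).not_ge
  have hst : s = t := le_antisymm (key h.symm) (key h)
  subst hst
  have h1 := mul_right_cancel₀ he.pos.ne' (add_left_cancel (add_right_cancel h))
  exact_mod_cast h1

/-- `z` is congruent to `1 + m e` modulo `e²`. -/
def IsPowCandidate (e m z : M) : Prop := IsPowTwo z ∧ ∃ t, z = 1 + m * e + e * e * t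

/-- A definable relation that says that `z = p ^ m` if `p` is a nonstandard power of two and `m`
is standard. -/
def IsPowOf (p m z : M) : Prop :=
  ∃ e, p = e + 1 ∧ IsPowCandidate e m z ∧ ∀ w, IsPowCandidate e m w → z ≤ w

theorem IsDef.isPowCandidate {Γ : Type*} [Context M Γ] {f g h : Γ → M} (hf : IsTerm f)
    (hg : IsTerm g) (hh : IsTerm h) : IsDef M fun x => IsPowCandidate (f x) (g x) (h x) :=
  .and (.isPowTwo hh) (.ex (.eq hh.lift (.add (.add (.const 1) (.mul hg.lift hf.lift))
    (.mul (.mul hf.lift hf.lift) .snd))))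

theorem IsDef.isPowOf {Γ : Type*} [Context M Γ] {f g h : Γ → M} (hf : IsTerm f)
    (hg : IsTerm g) (hh : IsTerm h) : IsDef M fun x => IsPowOf (f x) (g x) (h x) :=
  .ex (.and (.eq hf.lift (.add .snd (.const 1))) (.and (.isPowCandidate .snd hg.lift hh.lift)
    (.all (.imp (.isPowCandidate (IsTerm.lift .snd) hg.lift.lift .snd) (.le hh.lift.lift .snd)))))

theorem exists_eq_add_one {p : M} (hp : IsNonstandard p) : ∃ e, p = e + 1 ∧ IsNonstandard e := by
  obtain ⟨e, rfl⟩ := exists_add_of_le hp.one_lt.le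
  refine ⟨e, add_comm _ _, fun n => ?_⟩
  have := hp (n + 1)
  rw [Nat.cast_succ, add_comm] at this
  exact lt_of_add_lt_add_left this

/-- A power of two below `p ^ m` that is `1` modulo `e = p - 1` is some `p ^ j`, and its residue
modulo `e²` forces `j = m`. So `p ^ m` is the least candidate, and powers become definable without a
coding of sequences. -/
theorem isPowOf_iff {p : M} (hp : IsPowTwo p) (hpn : IsNonstandard p) (m : ℕ) {z : M} :
    IsPowOf p m z ↔ z = p ^ m := by
  obtain ⟨e, rfl, he⟩ := exists_eq_add_one hpn
  have hcand : IsPowCandidate e m ((e + 1) ^ m) := ⟨hp.pow m, exists_succ_pow_eq e m⟩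
  have hmin : ∀ w, IsPowCandidate e m w → (e + 1) ^ m ≤ w := by
    rintro w ⟨hw, t, ht⟩
    by_contra! hlt
    obtain ⟨j, -, rfl⟩ := hp.eq_pow_of_modEq he.pos.ne' m hw (m + e * t) (by rw [ht]; ring) hlt.le
    obtain ⟨s, hs⟩ := exists_succ_pow_eq e j
    rw [hs] at ht
    exact hlt.ne (by rw [natCast_eq_of_modEq he ht])
  constructor
  · rintro ⟨e', he', hz, hz'⟩
    obtain rfl := add_right_cancel he'
    exact le_antisymm (hz' _ hcand) (hmin z hz)
  · rintro rfl
    exact ⟨e, rfl, hcand, hmin⟩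

/-- Multiplication by `e + 1` raises the coefficient of `e` by one, so induction also reaches
nonstandard `m`. -/
theorem IsPowTwo.exists_modEq {e : M} (he : IsPowTwo (e + 1)) (m : M) :
    ∃ z, IsPowCandidate e m z := by
  refine induction (P := fun m => ∃ z, IsPowCandidate e m z) ?_ ?_ ?_ m
  · exact .ex (.isPowCandidate (.const e) (IsTerm.lift .self) .snd)
  · exact ⟨1, .one, 0, by simp⟩
  · rintro x ⟨z, hz, t, ht⟩
    refine ⟨z * (e + 1), hz.mul he, x + e * t + t, ?_⟩
    rw [ht]
    ring

/-- There is a function on nonstandard powers of two that grows more slowly than all roots, and is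
unbounded. -/
theorem exists_slow_growth : ∃ F : M → M, ∀ p, IsPowTwo p → IsNonstandard p →
    ∃ u, IsPowTwo u ∧ IsNonstandard u ∧ (∀ n : ℕ, u ^ n ≤ p) ∧
      ∀ v, IsPowTwo v → u < v → p < F v := by
  -- `F v` plays the role of `v ^ (v - 1)`: a power of two above `1` that is congruent to `1` modulo
  -- `(v - 1)²`.
  have hF : ∀ v : M, ∃ z, IsPowTwo v → 1 < v → IsPowTwo z ∧ 1 < z ∧
      ∃ e, v = e + 1 ∧ ∃ t, z = 1 + e * e * t := by
    intro v
    by_cases hv : IsPowTwo v ∧ 1 < v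
    · obtain ⟨hv, hv1⟩ := hv
      obtain ⟨e, rfl⟩ := exists_add_of_le hv1.le
      rw [add_comm] at hv hv1
      obtain ⟨z, hz, t, ht⟩ := hv.exists_modEq e
      refine ⟨z, fun _ _ => ⟨hz, ?_, e, add_comm _ _, 1 + t, by rw [ht]; ring⟩⟩
      have he : 0 < e := by
        by_contra! he
        rw [nonpos_iff_eq_zero.1 he] at hv1
        simp at hv1
      rw [ht, add_assoc]
      exact lt_add_of_pos_right _ (add_pos_of_pos_of_nonneg (mul_pos he he) zero_le)
    · exact ⟨0, fun h1 h2 => absurd ⟨h1, h2⟩ hv⟩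
  choose F hF using hF
  refine ⟨F, fun p hp hpn => ?_⟩
  -- `u` will be the greatest power of two for which such a `z` exists below `p`. All standard
  -- powers of two above `1` qualify, so `u` is nonstandard.
  let Q : M → Prop := fun u => IsPowTwo u ∧ 1 < u ∧ ∃ z, IsPowTwo z ∧ 1 < z ∧ z ≤ p ∧
    ∃ e, u = e + 1 ∧ ∃ t, z = 1 + e * e * t
  have hQ : IsDef M Q :=
    .and (.isPowTwo .self) (.and (.lt (.const 1) .self) (.ex (.and (.isPowTwo .snd)
      (.and (.lt (.const 1) .snd) (.and (.le .snd (.const p)) (.ex (.and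
        (.eq (IsTerm.lift (IsTerm.lift .self)) (.add .snd (.const 1)))
        (.ex (.eq (IsTerm.lift (IsTerm.lift .snd)) (.add (.const 1)
          (.mul (.mul (IsTerm.lift .snd) (IsTerm.lift .snd)) .snd)))))))))))
  have hstd : ∀ k : ℕ, Q (2 ^ (k + 1)) := by
    intro k
    have hpow : IsPowTwo ((2 : M) ^ (k + 1)) := by
      have := (IsPowTwo.one (M := M)).two_mul.pow (k + 1)
      rwa [mul_one] at this
    have h1 : (1 : M) < 2 ^ (k + 1) := one_lt_pow₀ one_lt_two (Nat.succ_ne_zero k)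
    obtain ⟨e, he⟩ := Nat.exists_eq_add_of_le' (Nat.one_le_two_pow (n := k + 1))
    have he' : (2 : M) ^ (k + 1) = (e : M) + 1 := by exact_mod_cast congrArg (Nat.cast (R := M)) he
    have he0 : e ≠ 0 := by
      rintro rfl
      rw [he'] at h1
      simp at h1
    refine ⟨hpow, h1, (2 ^ (k + 1)) ^ e, hpow.pow e, one_lt_pow₀ h1 he0, ?_, e, he', ?_⟩
    · have := (hpn ((2 ^ (k + 1)) ^ e)).le
      exact_mod_cast this
    · obtain ⟨t, ht⟩ := exists_succ_pow_eq (e : M) e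
      exact ⟨1 + t, by rw [he', ht]; ring⟩
  obtain ⟨u, ⟨hu, hu1, z, hz, hz1, hzp, e, rfl, t, ht⟩, hmax⟩ := exists_greatest hQ (b := p)
    (hstd 0) (by
      rintro _ ⟨hu, hu1, z, hz, hz1, hzp, e, rfl, t, rfl⟩
      refine le_trans ?_ hzp
      rw [add_comm]
      refine add_le_add_right ?_ 1
      have ht : t ≠ 0 := by rintro rfl; simp at hz1
      have he : e ≠ 0 := by rintro rfl; simp at hu1
      rw [mul_assoc]
      exact le_mul_of_one_le_right zero_le
        (IsPeanoModel.one_le_of_pos _ (pos_iff_ne_zero.2 (mul_ne_zero he ht))))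
  have hun : IsNonstandard (e + 1) := fun n => by
    refine lt_of_lt_of_le ?_ (hmax _ (hstd n))
    exact_mod_cast (Nat.lt_two_pow_self (n := n)).trans
      (Nat.pow_lt_pow_right one_lt_two n.lt_succ_self)
  have hen : IsNonstandard e := by
    obtain ⟨e', he', hn⟩ := exists_eq_add_one hun
    rwa [add_right_cancel he']
  refine ⟨e + 1, hu, hun, fun n => ?_, fun v hv huv => ?_⟩
  · refine le_trans ?_ hzp
    -- If `z` were below a standard power of `u = e + 1`, it would be `u ^ j` with `j` standard;
    -- being `1` modulo `e²` forces `j = 0`, against `1 < z`.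
    by_contra! hlt
    obtain ⟨j, -, hj⟩ := hu.eq_pow_of_modEq hen.pos.ne' n hz (e * t) (by rw [ht]; ring) hlt.le
    obtain ⟨s, hs⟩ := exists_succ_pow_eq e j
    rw [← hj, ht] at hs
    have hj0 : j = 0 := natCast_eq_of_modEq hen (j := j) (m := 0) (s := s) (t := t) (by
      rw [← hs]; simp)
    rw [hj0, pow_zero] at hj
    exact hz1.ne' hj
  · by_contra! hle
    obtain ⟨h1, h2, h3⟩ := hF v hv (hu1.trans huv)
    exact absurd (hmax v ⟨hv, hu1.trans huv, F v, h1, h2, hle, h3⟩) huv.not_ge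

/-- Between two nonstandard powers of two with very different exponents there is a third one. -/
theorem exists_between_pow {p q : M} (hp : IsPowTwo p) (hpn : IsNonstandard p)
    (h : ∀ n : ℕ, p ^ n ≤ q) : ∃ z, IsPowTwo z ∧ (∀ n : ℕ, p ^ n ≤ z) ∧ ∀ n : ℕ, z ^ n ≤ q := by
  -- For standard `k` the witness is `p ^ (k + 1)`; a nonstandard `k` gives one `z` that works for
  -- all standard exponents.
  obtain ⟨k, hk, z, hz, hpz⟩ := overspill (P := fun k => ∃ z, IsPowTwo z ∧ ∀ i, i ≤ k →
      ∃ a, ∃ b, IsPowOf p i a ∧ a ≤ z ∧ IsPowOf z i b ∧ b ≤ q)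
    (.ex (.and (.isPowTwo .snd) (.all (.imp (.le .snd (IsTerm.lift (IsTerm.lift .self)))
      (.ex (.ex (.and (.isPowOf (.const p) (IsTerm.lift (IsTerm.lift .snd)) (IsTerm.lift .snd))
        (.and (.le (IsTerm.lift .snd) (IsTerm.lift (IsTerm.lift (IsTerm.lift .snd))))
        (.and (.isPowOf (IsTerm.lift (IsTerm.lift (IsTerm.lift .snd)))
          (IsTerm.lift (IsTerm.lift .snd)) .snd) (.le .snd (.const q)))))))))))
    (fun k => by
      have hpk : IsPowTwo (p ^ (k + 1)) := hp.pow _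
      refine ⟨p ^ (k + 1), hpk, fun i hi => ?_⟩
      obtain ⟨i, hik, rfl⟩ := exists_natCast_of_le hi
      refine ⟨p ^ i, (p ^ (k + 1)) ^ i, (isPowOf_iff hp hpn i).2 rfl,
        pow_le_pow_right₀ hp.one_le (by omega), (isPowOf_iff hpk ?_ i).2 rfl, ?_⟩
      · exact hpn.mono (le_self_pow₀ hp.one_le k.succ_ne_zero)
      · rw [← pow_mul]
        exact h _) hpn
  have h1 : ∀ n : ℕ, p ^ n ≤ z := fun n => by
    obtain ⟨a, -, ha, haz, -⟩ := hpz n (hk n).le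
    rwa [(isPowOf_iff hp hpn n).1 ha] at haz
  refine ⟨z, hz, h1, fun n => ?_⟩
  obtain ⟨-, b, -, -, hb, hbq⟩ := hpz n (hk n).le
  rwa [(isPowOf_iff hz (hpn.mono (by simpa using h1 1)) n).1 hb] at hbq

end PeanoModel

/-! ### Coding traces on the natural numbers by prime divisors -/

namespace PeanoModel

section Coding

variable {M : Type*} [CommSemiring M] [LinearOrder M] [IsPeanoModel M]

/-- A definable relation that says that `z = 2 ^ k` if `u` is a nonstandard power of two and `k`
is standard. -/
def IsTwoPow (u k z : M) : Prop := ∃ a, ∃ b, IsPowOf u k a ∧ IsPowOf (2 * u) k b ∧ b = z * a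

theorem IsDef.isTwoPow {Γ : Type*} [Context M Γ] {f g h : Γ → M} (hf : IsTerm f)
    (hg : IsTerm g) (hh : IsTerm h) : IsDef M fun x => IsTwoPow (f x) (g x) (h x) :=
  .ex (.ex (.and (.isPowOf hf.lift.lift hg.lift.lift (IsTerm.lift .snd))
    (.and (.isPowOf (.mul (.const 2) hf.lift.lift) hg.lift.lift .snd)
      (.eq .snd (.mul hh.lift.lift (IsTerm.lift .snd))))))

/-- `IsPowOf` is correct only for nonstandard bases, so `2 ^ k` is obtained as the quotient of `(2 *
u) ^ k` by `u ^ k`. -/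
theorem isTwoPow_iff {u : M} (hu : IsPowTwo u) (hun : IsNonstandard u) (k : ℕ) {z : M} :
    IsTwoPow u k z ↔ z = 2 ^ k := by
  have h2 : IsNonstandard (2 * u) := hun.mono hu.lt_two_mul.le
  constructor
  · rintro ⟨a, b, ha, hb, hab⟩
    rw [isPowOf_iff hu hun] at ha
    rw [isPowOf_iff hu.two_mul h2] at hb
    subst ha hb
    rw [mul_pow] at hab
    exact (mul_right_cancel₀ (pow_ne_zero k hu.1) hab).symm
  · rintro rfl
    exact ⟨u ^ k, (2 * u) ^ k, (isPowOf_iff hu hun k).2 rfl, (isPowOf_iff hu.two_mul h2 k).2 rfl,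
      mul_pow _ _ _⟩

theorem IsNonstandard.exists_isPowTwo {e : M} (he : IsNonstandard e) :
    ∃ u : M, IsPowTwo u ∧ IsNonstandard u := by
  obtain ⟨z, hz, -, h⟩ := exists_isPowTwo_le_lt he.pos.ne'
  exact ⟨2 * z, hz.two_mul, he.mono h.le⟩

/-- Every bounded definable set of primes is the set of prime divisors of some element. -/
theorem exists_prime_dvd_iff {D : M → Prop} (hD : IsDef M D) (k : M) :
    ∃ c, ∀ p, Prime p → (p ∣ c ↔ D p ∧ p < k) := by
  refine induction (P := fun k => ∃ c, ∀ p, Prime p → (p ∣ c ↔ D p ∧ p < k)) ?_ ?_ ?_ k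
  · exact .ex (.all (.imp (.prime .snd) (.iff (.dvd .snd (IsTerm.lift .snd))
      (.and hD.snd (.lt .snd (IsTerm.lift (IsTerm.lift .self)))))))
  · refine ⟨1, fun p hp => ⟨fun h => absurd (isUnit_of_dvd_one h) hp.not_isUnit, ?_⟩⟩
    rintro ⟨-, h⟩
    exact absurd h zero_le.not_gt
  · rintro k ⟨c, hc⟩
    by_cases hk : Prime k ∧ D k
    · refine ⟨c * k, fun p hp => ?_⟩
      rw [hp.dvd_mul, hc p hp, lt_add_one_iff]
      constructor
      · rintro (⟨h1, h2⟩ | h)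
        · exact ⟨h1, h2.le⟩
        · obtain rfl := eq_of_prime_dvd_prime hp hk.1 h
          exact ⟨hk.2, le_rfl⟩
      · rintro ⟨h1, h2⟩
        rcases h2.lt_or_eq with h2 | rfl
        · exact Or.inl ⟨h1, h2⟩
        · exact Or.inr dvd_rfl
    · refine ⟨c, fun p hp => ?_⟩
      rw [hc p hp, lt_add_one_iff]
      refine and_congr_right fun h1 => ⟨le_of_lt, fun h2 => h2.lt_of_ne ?_⟩
      rintro rfl
      exact hk ⟨hp, h1⟩

/-- A pairing of natural numbers given by a polynomial. -/
theorem pairing_injective {m n m' n' : ℕ}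
    (h : (m + n) * (m + n) + m = (m' + n') * (m' + n') + m') : m = m' ∧ n = n' := by
  have h1 : m + n = m' + n' := by
    rcases lt_trichotomy (m + n) (m' + n') with hlt | heq | hgt
    · nlinarith
    · exact heq
    · nlinarith
  rw [h1] at h
  omega

theorem two_pow_window_unique {j k l : ℕ} (hj : 2 * 2 ^ j ≤ l) (hj' : l < 4 * 2 ^ j)
    (hk : 2 * 2 ^ k ≤ l) (hk' : l < 4 * 2 ^ k) : j = k := by
  have key : ∀ {j k : ℕ}, 2 * 2 ^ j ≤ l → l < 4 * 2 ^ k → j ≤ k := by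
    intro j k h1 h2
    have h3 : 2 ^ (j + 1) < 2 ^ (k + 2) := by
      rw [pow_succ, pow_add]
      omega
    have := (Nat.pow_lt_pow_iff_right (by norm_num)).1 h3
    omega
  exact le_antisymm (key hj hk') (key hk hj')

/-- Bertrand's postulate. These windows are disjoint for different `k`, so a set of numbers `k` can
be coded by primes without defining the enumeration of primes inside the model. -/
theorem exists_prime_window (k : ℕ) : ∃ l, l.Prime ∧ 2 * 2 ^ k ≤ l ∧ l < 4 * 2 ^ k := by
  obtain ⟨l, hl, h1, h2⟩ := Nat.exists_prime_lt_and_le_two_mul (2 * 2 ^ k) (by positivity)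
  refine ⟨l, hl, h1.le, lt_of_le_of_ne (by omega) ?_⟩
  rintro rfl
  have h3 : 4 * 2 ^ k = 2 * (2 * 2 ^ k) := by ring
  rw [h3] at hl
  exact Nat.not_prime_mul (by norm_num) (by have := Nat.one_le_two_pow (n := k); omega) hl

/-- The trace on `ℕ` of a definable binary relation is encoded by a set of primes. -/
theorem exists_prime_code {D : M → M → Prop} (hD : IsDef M fun z : M × M => D z.1 z.2)
    {e : M} (he : IsNonstandard e) : ∃ c : M, ∀ l : ℕ, l.Prime → ((l : M) ∣ c ↔
      ∃ m n : ℕ, D m n ∧ 2 * 2 ^ ((m + n) * (m + n) + m) ≤ l ∧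
        l < 4 * 2 ^ ((m + n) * (m + n) + m)) := by
  obtain ⟨u, hu, hun⟩ := he.exists_isPowTwo
  -- The bounds `m ≤ l` and `n ≤ l` force the witnesses to be standard when `l` is.
  obtain ⟨c, hc⟩ := exists_prime_dvd_iff (D := fun l : M => ∃ m, ∃ n, ∃ z, D m n ∧
    IsTwoPow u ((m + n) * (m + n) + m) z ∧ 2 * z ≤ l ∧ l < 4 * z ∧ m ≤ l ∧ n ≤ l)
    (.ex (.ex (.ex (.and (hD.subst₂ (IsTerm.lift (IsTerm.lift .snd)) (IsTerm.lift .snd))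
      (.and (.isTwoPow (.const u) (.add (.mul (.add (IsTerm.lift (IsTerm.lift .snd))
        (IsTerm.lift .snd)) (.add (IsTerm.lift (IsTerm.lift .snd)) (IsTerm.lift .snd)))
        (IsTerm.lift (IsTerm.lift .snd))) .snd)
      (.and (.le (.mul (.const 2) .snd) (IsTerm.lift (IsTerm.lift (IsTerm.lift .self))))
      (.and (.lt (IsTerm.lift (IsTerm.lift (IsTerm.lift .self))) (.mul (.const 4) .snd))
      (.and (.le (IsTerm.lift (IsTerm.lift .snd)) (IsTerm.lift (IsTerm.lift (IsTerm.lift .self))))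
      (.le (IsTerm.lift .snd) (IsTerm.lift (IsTerm.lift (IsTerm.lift .self)))))))))))) e
  refine ⟨c, fun l hl => ?_⟩
  rw [hc _ (prime_natCast hl), and_iff_left (he l)]
  have hcast : ∀ m n : ℕ, ((m : M) + n) * (m + n) + m = ((m + n) * (m + n) + m : ℕ) :=
    fun m n => by push_cast; rfl
  constructor
  · rintro ⟨m, n, z, hmn, hz, h1, h2, hm, hn⟩
    obtain ⟨m, -, rfl⟩ := exists_natCast_of_le hm
    obtain ⟨n, -, rfl⟩ := exists_natCast_of_le hn
    rw [hcast, isTwoPow_iff hu hun] at hz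
    subst hz
    exact ⟨m, n, hmn, by exact_mod_cast h1, by exact_mod_cast h2⟩
  · rintro ⟨m, n, hmn, h1, h2⟩
    have h3 : (m + n) * (m + n) + m < l := by
      refine lt_of_lt_of_le (Nat.lt_two_pow_self) (le_trans ?_ h1)
      omega
    refine ⟨m, n, 2 ^ ((m + n) * (m + n) + m), hmn, ?_, by exact_mod_cast h1,
      by exact_mod_cast h2, ?_, ?_⟩
    · rw [hcast, isTwoPow_iff hu hun]
    · exact_mod_cast (Nat.le_add_left _ _).trans h3.le
    · have : n ≤ (m + n) * (m + n) + m := by nlinarith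
      exact_mod_cast this.trans h3.le

/-- A set of primes encodes the trace on `ℕ` of a definable binary relation. -/
theorem exists_isDef_of_prime_code (c : M) {e : M} (he : IsNonstandard e) :
    ∃ D : M → M → Prop, IsDef M (fun z : M × M => D z.1 z.2) ∧ ∀ m n : ℕ, D m n ↔
      ∃ l : ℕ, l.Prime ∧ (l : M) ∣ c ∧ 2 * 2 ^ ((m + n) * (m + n) + m) ≤ l ∧
        l < 4 * 2 ^ ((m + n) * (m + n) + m) := by
  obtain ⟨u, hu, hun⟩ := he.exists_isPowTwo
  refine ⟨fun m n => ∃ l, ∃ z, IsTwoPow u ((m + n) * (m + n) + m) z ∧ Prime l ∧ l ∣ c ∧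
    2 * z ≤ l ∧ l < 4 * z, ?_, fun m n => ?_⟩
  · have h1 : IsTerm fun z : ((M × M) × M) × M => z.1.1.1 :=
      IsTerm.lift (IsTerm.lift (IsTerm.lift .self))
    have h2 : IsTerm fun z : ((M × M) × M) × M => z.1.1.2 := IsTerm.lift (IsTerm.lift .snd)
    exact .ex (.ex (.and (.isTwoPow (.const u) (.add (.mul (.add h1 h2) (.add h1 h2)) h1) .snd)
      (.and (.prime (IsTerm.lift .snd)) (.and (.dvd (IsTerm.lift .snd) (.const c))
      (.and (.le (.mul (.const 2) .snd) (IsTerm.lift .snd))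
        (.lt (IsTerm.lift .snd) (.mul (.const 4) .snd)))))))
  · have hcast : ((m : M) + n) * (m + n) + m = ((m + n) * (m + n) + m : ℕ) := by push_cast; rfl
    beta_reduce
    rw [hcast]
    constructor
    · rintro ⟨l, z, hz, hl, hlc, h1, h2⟩
      rw [isTwoPow_iff hu hun] at hz
      subst hz
      obtain ⟨l, -, rfl⟩ := exists_natCast_of_le
        (n := 4 * 2 ^ ((m + n) * (m + n) + m)) (by exact_mod_cast h2.le)
      exact ⟨l, nat_prime_of_prime hl, hlc, by exact_mod_cast h1, by exact_mod_cast h2⟩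
    · rintro ⟨l, hl, hlc, h1, h2⟩
      exact ⟨l, _, (isTwoPow_iff hu hun _).2 rfl, prime_natCast hl, hlc, by exact_mod_cast h1,
        by exact_mod_cast h2⟩

theorem exists_isPowOf_le_iff {x y : M} (hx : IsPowTwo x) (hxn : IsNonstandard x)
    (hy : IsPowTwo y) (hyn : IsNonstandard y) (m n : ℕ) :
    (∃ a, ∃ b, IsPowOf x m a ∧ IsPowOf y n b ∧ a ≤ b) ↔ x ^ m ≤ y ^ n := by
  constructor
  · rintro ⟨a, b, ha, hb, hab⟩
    rwa [(isPowOf_iff hx hxn m).1 ha, (isPowOf_iff hy hyn n).1 hb] at hab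
  · intro h
    exact ⟨_, _, (isPowOf_iff hx hxn m).2 rfl, (isPowOf_iff hy hyn n).2 rfl, h⟩

end Coding

/-! ### Transfer of ratios between models with the same standard system -/

section Transfer

variable {M N : Type*} [CommSemiring M] [LinearOrder M] [IsPeanoModel M]
  [CommSemiring N] [LinearOrder N] [IsPeanoModel N]

/-- Nonstandard models with the same standard system have the same traces on `ℕ` of definable
binary relations. -/
theorem exists_isDef_of_standardSystem_eq (hSS : standardSystem M = standardSystem N)
    {e : M} (he : IsNonstandard e) {e' : N} (he' : IsNonstandard e')
    {D : M → M → Prop} (hD : IsDef M fun z : M × M => D z.1 z.2) :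
    ∃ D' : N → N → Prop, IsDef N (fun z : N × N => D' z.1 z.2) ∧ ∀ m n : ℕ, D' m n ↔ D m n := by
  obtain ⟨c, hc⟩ := exists_prime_code hD he
  obtain ⟨c', hc'⟩ : {n : ℕ | ((Nat.nth Nat.Prime n : ℕ) : M) ∣ c} ∈ standardSystem N :=
    hSS ▸ ⟨c, rfl⟩
  have hcc : ∀ l : ℕ, l.Prime → ((l : N) ∣ c' ↔ (l : M) ∣ c) := fun l hl => by
    have := Set.ext_iff.1 hc' (Nat.count Nat.Prime l)
    simpa [Nat.nth_count hl] using this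
  obtain ⟨D', hD', h⟩ := exists_isDef_of_prime_code c' he'
  refine ⟨D', hD', fun m n => (h m n).trans ⟨?_, fun hmn => ?_⟩⟩
  · rintro ⟨l, hl, hlc, h1, h2⟩
    obtain ⟨m', n', hmn, h3, h4⟩ := (hc l hl).1 ((hcc l hl).1 hlc)
    obtain ⟨rfl, rfl⟩ := pairing_injective (two_pow_window_unique h1 h2 h3 h4)
    exact hmn
  · obtain ⟨l, hl, h1, h2⟩ := exists_prime_window ((m + n) * (m + n) + m)
    exact ⟨l, hl, (hcc l hl).2 ((hc l hl).2 ⟨m, n, hmn, h1, h2⟩), h1, h2⟩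

/-- An initial segment of the comparisons between powers of `x` and `y` is realized over any
nonstandard power of two. -/
theorem exists_pow_le_iff_of_lt {x y : M} (hxn : IsNonstandard x) {x' : N} (hx' : IsPowTwo x') (hxn' : IsNonstandard x') {n₀ K : ℕ}
    (hn₀ : x ≤ y ^ n₀) (hK : n₀ < K) (hK1 : 1 < K) : ∃ y' : N, IsPowTwo y' ∧ IsNonstandard y' ∧
      ∀ m n : ℕ, m < K → n < K → (x ^ m ≤ y ^ n ↔ x' ^ m ≤ y' ^ n) := by
  classical
  have hn₀0 : n₀ ≠ 0 := by
    rintro rfl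
    rw [pow_zero] at hn₀
    exact absurd hxn.one_lt hn₀.not_gt
  -- The best lower bound `u / v` for the ratio of the logarithms of `y` and `x` with entries below
  -- `K`; `y'` is then chosen with ratio `u / v` over `x'`, up to a finite factor.
  let s : Finset (ℕ × ℕ) := ((Finset.range K) ×ˢ (Finset.range K)).filter
    fun z => z.2 ≠ 0 ∧ x ^ z.1 ≤ y ^ z.2
  have hs : ∀ m n, (m, n) ∈ s ↔ (m < K ∧ n < K) ∧ n ≠ 0 ∧ x ^ m ≤ y ^ n := fun m n => by
    simp [s]
  have hs₀ : (1, n₀) ∈ s := (hs _ _).2 ⟨⟨hK1, hK⟩, hn₀0, by rwa [pow_one]⟩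
  obtain ⟨⟨u, v⟩, huv, hmax⟩ := s.exists_max_image (fun z => (z.1 : ℚ) / z.2) ⟨_, hs₀⟩
  obtain ⟨⟨huK, hvK⟩, hv0, hxy⟩ := (hs u v).1 huv
  have hmax' : ∀ m n, (m, n) ∈ s → m * v ≤ u * n := fun m n hmn => by
    have := hmax _ hmn
    have hn : (0 : ℚ) < n := by
      exact_mod_cast Nat.pos_of_ne_zero ((hs m n).1 hmn).2.1
    rw [div_le_div_iff₀ hn (by exact_mod_cast Nat.pos_of_ne_zero hv0)] at this
    exact_mod_cast this
  have hu0 : u ≠ 0 := by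
    rintro rfl
    have := hmax' _ _ hs₀
    omega
  obtain ⟨w, hw, hw1, hw2⟩ := (hx'.pow u).exists_root hv0
  have hyn' : IsNonstandard (2 * w) := fun n => by
    by_contra! h
    have h1 : x' ≤ (n : N) ^ v := (le_self_pow₀ hx'.one_le hu0).trans
      (hw2.le.trans (pow_le_pow_left₀ zero_le h v))
    exact absurd (hxn' (n ^ v)) (by exact_mod_cast h1.not_gt)
  -- The root is rounded up, so `x' ^ u` is below the `v`-th power of `y'` and all true inequalities
  -- survive.
  refine ⟨2 * w, hw.two_mul, hyn', fun m n hm hn => ?_⟩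
  constructor
  · intro h
    by_cases hn0 : n = 0
    · subst hn0
      have hm0 : m = 0 := by
        by_contra hm0
        rw [pow_zero] at h
        exact absurd (one_lt_pow₀ hxn.one_lt hm0) h.not_gt
      simp [hm0]
    · have h1 := hmax' m n ((hs m n).2 ⟨⟨hm, hn⟩, hn0, h⟩)
      have h2 : (x' ^ m) ^ v ≤ ((2 * w) ^ n) ^ v := by
        calc (x' ^ m) ^ v = x' ^ (m * v) := (pow_mul _ _ _).symm
          _ ≤ x' ^ (u * n) := pow_le_pow_right₀ hx'.one_le h1
          _ = (x' ^ u) ^ n := pow_mul _ _ _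
          _ ≤ ((2 * w) ^ v) ^ n := pow_le_pow_left₀ zero_le hw2.le n
          _ = ((2 * w) ^ n) ^ v := pow_right_comm _ _ _
      exact le_of_pow_le_pow_left₀ hv0 zero_le h2
  · intro h
    by_contra! h'
    have h1 : u * n < m * v := by
      have h2 : x ^ (u * n) < x ^ (m * v) := by
        calc x ^ (u * n) = (x ^ u) ^ n := pow_mul _ _ _
          _ ≤ (y ^ v) ^ n := pow_le_pow_left₀ zero_le hxy n
          _ = (y ^ n) ^ v := pow_right_comm _ _ _
          _ < (x ^ m) ^ v := pow_lt_pow_left₀ h' zero_le hv0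
          _ = x ^ (m * v) := (pow_mul _ _ _).symm
      exact (pow_lt_pow_iff_right₀ hxn.one_lt).1 h2
    -- Rounding up costs at most the standard factor `2 ^ (v * n)`. It is smaller than `x'`, and `u
    -- * n < m * v` leaves a full factor `x'` to spare.
    have h2 : ((2 * w) ^ n) ^ v < (x' ^ m) ^ v := by
      calc ((2 * w) ^ n) ^ v = (2 ^ v * w ^ v) ^ n := by rw [pow_right_comm, mul_pow]
        _ ≤ (2 ^ v * x' ^ u) ^ n := pow_le_pow_left₀ zero_le (mul_le_mul_right hw1 _) n
        _ = x' ^ (u * n) * 2 ^ (v * n) := by rw [mul_pow, ← pow_mul, ← pow_mul, mul_comm]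
        _ < x' ^ (u * n) * x' := by
          refine mul_lt_mul_of_pos_left ?_ (hx'.pow _).pos
          exact_mod_cast hxn' (2 ^ (v * n))
        _ = x' ^ (u * n + 1) := (pow_succ _ _).symm
        _ ≤ x' ^ (m * v) := pow_le_pow_right₀ hx'.one_le h1
        _ = (x' ^ m) ^ v := pow_mul _ _ _
    exact absurd h2 (pow_le_pow_left₀ zero_le h v).not_gt

/-- Models with the same standard system realize the same ratios of logarithms. -/
theorem exists_pow_le_iff (hSS : standardSystem M = standardSystem N) {x y : M} (hx : IsPowTwo x)
    (hxn : IsNonstandard x) (hy : IsPowTwo y) (hyn : IsNonstandard y) {x' : N} (hx' : IsPowTwo x')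
    (hxn' : IsNonstandard x') {n₀ : ℕ} (hn₀ : x ≤ y ^ n₀) : ∃ y' : N, IsPowTwo y' ∧
      IsNonstandard y' ∧ ∀ m n : ℕ, x ^ m ≤ y ^ n ↔ x' ^ m ≤ y' ^ n := by
  obtain ⟨D, hD, hDxy⟩ := exists_isDef_of_standardSystem_eq hSS hxn hxn'
    (D := fun m n => ∃ a, ∃ b, IsPowOf x m a ∧ IsPowOf y n b ∧ a ≤ b)
    (.ex (.ex (.and (.isPowOf (.const x) (IsTerm.lift (IsTerm.lift (IsTerm.lift .self)))
      (IsTerm.lift .snd)) (.and (.isPowOf (.const y) (IsTerm.lift (IsTerm.lift .snd)) .snd)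
      (.le (IsTerm.lift .snd) .snd)))))
  have hDxy' : ∀ m n : ℕ, D m n ↔ x ^ m ≤ y ^ n := fun m n => by
    rw [hDxy, exists_isPowOf_le_iff hx hxn hy hyn]
  -- `D` carries the comparisons of `x` and `y` into `N`, where overspill passes from finite stages
  -- to all standard exponents. The clause `K ≤ y'` makes `y'` nonstandard.
  obtain ⟨K, hKn, y', hy', hKy, h⟩ := overspill (P := fun K : N => ∃ y', IsPowTwo y' ∧ K ≤ y' ∧
    ∀ m, ∀ n, m < K → n < K →
      (D m n ↔ ∃ a, ∃ b, IsPowOf x' m a ∧ IsPowOf y' n b ∧ a ≤ b))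
    (.ex (.and (.isPowTwo .snd) (.and (.le (IsTerm.lift .self) .snd) (.all (.all
      (.imp (.lt (IsTerm.lift .snd) (IsTerm.lift (IsTerm.lift (IsTerm.lift .self))))
      (.imp (.lt .snd (IsTerm.lift (IsTerm.lift (IsTerm.lift .self))))
      (.iff (hD.subst₂ (IsTerm.lift .snd) .snd)
      (.ex (.ex (.and (.isPowOf (.const x') (IsTerm.lift (IsTerm.lift (IsTerm.lift .snd)))
        (IsTerm.lift .snd))
      (.and (.isPowOf (IsTerm.lift (IsTerm.lift (IsTerm.lift (IsTerm.lift .snd))))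
        (IsTerm.lift (IsTerm.lift .snd)) .snd)
      (.le (IsTerm.lift .snd) .snd)))))))))))))
    (fun K => by
      obtain ⟨y', hy', hyn', h⟩ := exists_pow_le_iff_of_lt hxn hx' hxn' (K := K + n₀ + 2) hn₀
        (by omega) (by omega)
      refine ⟨y', hy', (hyn' K).le, fun m n hm hn => ?_⟩
      obtain ⟨m, -, rfl⟩ := exists_natCast_of_le hm.le
      obtain ⟨n, -, rfl⟩ := exists_natCast_of_le hn.le
      have hm' : m < K := by exact_mod_cast hm
      have hn' : n < K := by exact_mod_cast hn
      rw [hDxy', exists_isPowOf_le_iff hx' hxn' hy' hyn']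
      exact h m n (by omega) (by omega)) hxn'
  have hyn' : IsNonstandard y' := hKn.mono hKy
  refine ⟨y', hy', hyn', fun m n => ?_⟩
  have := h m n (hKn m) (hKn n)
  rwa [hDxy', exists_isPowOf_le_iff hx' hxn' hy' hyn'] at this

end Transfer

end PeanoModel

/-! ### Rational scalars on a divisible ordered group -/

namespace OrderedRatModule

/-- The `ℚ`-module structure of a divisible ordered group. -/
noncomputable abbrev ofDivisible {G : Type*} [AddCommGroup G] [LinearOrder G] [IsOrderedAddMonoid G]
    (hdiv : ∀ n : ℕ, n ≠ 0 → ∀ g : G, ∃ h, n • h = g) : Module ℚ G :=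
  have inj : ∀ {n : ℤ}, n ≠ 0 → ∀ {x y : G}, n • x = n • y → x = y := fun hn _ _ h =>
    zsmul_right_injective hn h
  let div : ℕ → G → G := fun n g => if hn : n = 0 then 0 else (hdiv n hn g).choose
  have div_spec : ∀ {n : ℕ}, n ≠ 0 → ∀ g, n • div n g = g := fun {n} hn g => by
    simp only [div, dif_neg hn]
    exact (hdiv n hn g).choose_spec
  let sm : ℚ → G → G := fun q g => div q.den (q.num • g)
  -- The group is torsion-free, so the module laws follow by clearing denominators with `key`.
  have key : ∀ (q : ℚ) (g : G) (n m : ℤ), q * n = m → n • sm q g = m • g := fun q g n m h => by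
    have hd : (q.den : ℤ) ≠ 0 := by exact_mod_cast q.den_ne_zero
    have h1 : (q.den : ℤ) • sm q g = q.num • g := by
      rw [natCast_zsmul]
      exact div_spec q.den_ne_zero _
    have h2 : n * q.num = m * q.den := by
      have h3 : q * q.den = q.num := Rat.mul_den_eq_num q
      have h4 : (n : ℚ) * q.num = m * q.den := by rw [← h3, ← h]; ring
      exact_mod_cast h4
    refine inj hd ?_
    rw [smul_comm, h1, smul_smul, smul_smul, h2, mul_comm]
  have ext : ∀ (q : ℚ) (g x : G), (q.den : ℤ) • x = q.num • g → sm q g = x := fun q g x h =>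
    inj (n := q.den) (by exact_mod_cast q.den_ne_zero) (by
      rw [h]
      exact key q g _ _ (by exact_mod_cast Rat.mul_den_eq_num q))
  have hden : ∀ q : ℚ, (q.den : ℤ) ≠ 0 := fun q => by exact_mod_cast q.den_ne_zero
  { smul := sm
    one_smul := fun g => ext 1 g g (by simp)
    mul_smul := fun q r g => by
      change sm (q * r) g = sm q (sm r g)
      have h1 := key r g r.den r.num (by exact_mod_cast Rat.mul_den_eq_num r)
      have h2 := key q (sm r g) q.den q.num (by exact_mod_cast Rat.mul_den_eq_num q)
      refine inj (mul_ne_zero (hden r) (hden q)) ?_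
      rw [key (q * r) g (r.den * q.den) (r.num * q.num) (by
        push_cast
        rw [← Rat.mul_den_eq_num r, ← Rat.mul_den_eq_num q]; ring), mul_smul (r.den : ℤ), h2,
        smul_comm (r.den : ℤ), h1, smul_smul, mul_comm]
    smul_zero := fun q => ext q 0 0 (by simp)
    smul_add := fun q x y => by
      refine ext q (x + y) _ ?_
      have h1 := key q x q.den q.num (by exact_mod_cast Rat.mul_den_eq_num q)
      have h2 := key q y q.den q.num (by exact_mod_cast Rat.mul_den_eq_num q)
      exact (smul_add _ _ _).trans ((congrArg₂ (· + ·) h1 h2).trans (smul_add _ _ _).symm)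
    add_smul := fun q r g => by
      change sm (q + r) g = sm q g + sm r g
      have h1 := key r g (r.den * q.den) (r.num * q.den) (by
        push_cast
        rw [← Rat.mul_den_eq_num r]; ring)
      have h2 := key q g (r.den * q.den) (q.num * r.den) (by
        push_cast
        rw [← Rat.mul_den_eq_num q]; ring)
      refine inj (mul_ne_zero (hden r) (hden q)) ?_
      rw [smul_add, h1, h2, ← add_smul]
      refine key (q + r) g _ _ ?_
      push_cast
      rw [← Rat.mul_den_eq_num r, ← Rat.mul_den_eq_num q]; ring
    zero_smul := fun g => ext 0 g 0 (by simp) }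

end OrderedRatModule

/-! ### Logarithms: from arithmetic to the ordered group -/

namespace PeanoModel

theorem countable_Iic {M : Type*} [CommSemiring M] [LinearOrder M] [IsPeanoModel M]
    (hM : IsOmegaOneLike M) (a : M) : (Set.Iic a).Countable := by
  refine hM.2 _ (isLowerSet_Iic a) fun h => ?_
  have : a + 1 ∈ Set.Iic a := h ▸ Set.mem_univ _
  exact absurd (lt_add_one_iff.2 le_rfl) (not_lt.2 this)

/-- A map `L` from the nonzero elements of `M` to an ordered group that behaves like the class of
the logarithm up to finite elements. -/
structure IsLogarithm {M : Type*} [CommSemiring M] [LinearOrder M] {G : Type*} [AddCommGroup G]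
    [LinearOrder G] (L : M → G) : Prop where
  map_mul : ∀ a b, a ≠ 0 → b ≠ 0 → L (a * b) = L a + L b
  le_iff : ∀ a b, a ≠ 0 → b ≠ 0 → (L a ≤ L b ↔ ∃ n : ℕ, a ≤ n * b)
  exists_nsmul : ∀ g, ∃ n : ℕ, n ≠ 0 ∧ ∃ a b, a ≠ 0 ∧ b ≠ 0 ∧ n • g + L a = L b

namespace IsLogarithm

section

variable {M : Type*} [CommSemiring M] [LinearOrder M] [IsPeanoModel M]
  {G : Type*} [AddCommGroup G] [LinearOrder G] [IsOrderedAddMonoid G]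
  {L : M → G} (hL : IsLogarithm L)
include hL

theorem map_one : L 1 = 0 := by
  have := hL.map_mul 1 1 one_ne_zero one_ne_zero
  simpa using this

theorem map_pow {a : M} (ha : a ≠ 0) (n : ℕ) : L (a ^ n) = n • L a := by
  induction n with
  | zero => simpa using hL.map_one
  | succ n ih => rw [pow_succ, hL.map_mul _ _ (pow_ne_zero n ha) ha, ih, succ_nsmul]

theorem mono {a b : M} (ha : a ≠ 0) (hab : a ≤ b) : L a ≤ L b :=
  (hL.le_iff a b ha (fun h => ha (by simpa [h] using hab))).2 ⟨1, by simpa using hab⟩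

theorem lt_of_lt {a b : M} (hb : b ≠ 0) (h : L a < L b) : a < b := by
  by_contra! hba
  exact absurd (hL.mono hb hba) h.not_ge

theorem pos_iff {a : M} (ha : a ≠ 0) : 0 < L a ↔ IsNonstandard a := by
  rw [← not_le, ← hL.map_one, hL.le_iff a 1 ha one_ne_zero]
  simp [IsNonstandard]

theorem exists_isPowTwo_eq {a : M} (ha : a ≠ 0) : ∃ p, IsPowTwo p ∧ L p = L a := by
  obtain ⟨p, hp, h1, h2⟩ := exists_isPowTwo_le_lt ha
  exact ⟨p, hp, le_antisymm (hL.mono hp.1 h1) ((hL.le_iff a p ha hp.1).2 ⟨2, by simpa using h2.le⟩)⟩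

theorem exists_nsmul_eq {z : M} (hz : IsPowTwo z) {n : ℕ} (hn : n ≠ 0) :
    ∃ w, IsPowTwo w ∧ n • L w = L z := by
  obtain ⟨w, hw, h1, h2⟩ := hz.exists_root hn
  refine ⟨w, hw, ?_⟩
  rw [← hL.map_pow hw.1]
  refine le_antisymm (hL.mono (hw.pow n).1 h1) ((hL.le_iff _ _ hz.1 (hw.pow n).1).2 ⟨2 ^ n, ?_⟩)
  push_cast
  rw [← mul_pow]
  exact h2.le

/-- Write `n • g` as `L d - L c` with powers of two `c` and `d`. If `c ≤ d`, then `c` divides `d`,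
the quotient is a power of two, and an approximate `n`-th root of it has logarithm `g`; otherwise `g
= 0`. -/
theorem exists_eq {g : G} (hg : 0 ≤ g) : ∃ p, IsPowTwo p ∧ L p = g := by
  obtain ⟨n, hn, a, b, ha, hb, h⟩ := hL.exists_nsmul g
  obtain ⟨c, hc, hca⟩ := hL.exists_isPowTwo_eq ha
  obtain ⟨d, hd, hdb⟩ := hL.exists_isPowTwo_eq hb
  rw [← hca, ← hdb] at h
  rcases le_total c d with hcd | hdc
  · obtain ⟨s, rfl⟩ := hc.dvd_of_le hd hcd
    have hs : IsPowTwo s := hd.of_dvd (dvd_mul_left _ _)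
    rw [hL.map_mul c s hc.1 hs.1, add_comm (L c), add_left_inj] at h
    obtain ⟨w, hw, hws⟩ := hL.exists_nsmul_eq hs hn
    exact ⟨w, hw, nsmul_right_injective hn (hws.trans h.symm)⟩
  · have h1 : n • g ≤ 0 := by
      have := hL.mono hd.1 hdc
      rwa [← h, add_le_iff_nonpos_left] at this
    have h2 : n • g = n • (0 : G) := by
      rw [nsmul_zero]
      exact le_antisymm h1 (nsmul_nonneg hg n)
    exact ⟨1, .one, hL.map_one.trans (nsmul_right_injective hn h2).symm⟩

theorem exists_nonstandard_eq {g : G} (hg : 0 < g) :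
    ∃ p, IsPowTwo p ∧ IsNonstandard p ∧ L p = g := by
  obtain ⟨p, hp, rfl⟩ := hL.exists_eq hg.le
  exact ⟨p, hp, (hL.pos_iff hp.1).1 hg, rfl⟩

theorem divisible (n : ℕ) (hn : n ≠ 0) (g : G) : ∃ h, n • h = g := by
  have key : ∀ g : G, 0 ≤ g → ∃ h, n • h = g := fun g hg => by
    obtain ⟨p, hp, rfl⟩ := hL.exists_eq hg
    obtain ⟨w, -, h⟩ := hL.exists_nsmul_eq hp hn
    exact ⟨_, h⟩
  rcases le_total 0 g with hg | hg
  · exact key g hg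
  · obtain ⟨h, hh⟩ := key (-g) (neg_nonneg.2 hg)
    exact ⟨-h, by rw [smul_neg, hh, neg_neg]⟩

theorem countable_mul (hM : IsOmegaOneLike M) (a : M) : {x : M | ∃ n : ℕ, x ≤ n * a}.Countable := by
  refine (Set.countable_iUnion fun n : ℕ => countable_Iic hM (n * a)).mono ?_
  rintro x ⟨n, hn⟩
  exact Set.mem_iUnion.2 ⟨n, hn⟩

theorem countable_abs_le (hM : IsOmegaOneLike M) (b : G) : {x : G | |x| ≤ b}.Countable := by
  rcases lt_or_ge b 0 with hb | hb
  · refine Set.Countable.mono (fun x hx => ?_) Set.countable_empty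
    exact absurd (hx.trans_lt hb) (abs_nonneg x).not_gt
  · obtain ⟨q, hq, rfl⟩ := hL.exists_eq hb
    have hc := (hL.countable_mul hM q).image L
    refine (hc.union (hc.image Neg.neg)).mono fun x hx => ?_
    obtain ⟨p, hp, hpx⟩ := hL.exists_eq (abs_nonneg x)
    have hmem : |x| ∈ L '' {x : M | ∃ n : ℕ, x ≤ n * q} :=
      ⟨p, (hL.le_iff p q hp.1 hq.1).1 (hpx ▸ hx), hpx⟩
    rcases abs_choice x with h | h
    · exact Or.inl (h ▸ hmem)
    · exact Or.inr ⟨|x|, hmem, by rw [h, neg_neg]⟩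

/-- The fibres of `L` on nonzero elements are countable, as each is bounded by the standard
multiples of one element. -/
theorem uncountable (hM : IsOmegaOneLike M) : Uncountable G := by
  have := hM.1
  by_contra hG
  rw [not_uncountable_iff] at hG
  refine Set.not_countable_univ (α := M) ?_
  have hfib : ∀ g : G, {a : M | a ≠ 0 ∧ L a = g}.Countable := by
    intro g
    by_cases h : ∃ a, a ≠ 0 ∧ L a = g
    · obtain ⟨a, ha, rfl⟩ := h
      exact (hL.countable_mul hM a).mono fun x hx => (hL.le_iff x a hx.1 ha).1 hx.2.le
    · refine Set.Countable.mono (fun x hx => ?_) Set.countable_empty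
      exact absurd ⟨x, hx⟩ h
  refine ((Set.countable_iUnion hfib).insert 0).mono fun x _ => ?_
  by_cases hx : x = 0
  · exact Or.inl hx
  · exact Or.inr (Set.mem_iUnion.2 ⟨L x, hx, rfl⟩)

theorem mk_lt_mk_of_pow_le {p q : M} (hp : p ≠ 0) (hpn : IsNonstandard p)
    (h : ∀ n : ℕ, p ^ n ≤ q) : ArchimedeanClass.mk (L q) < ArchimedeanClass.mk (L p) := by
  have hp0 := (hL.pos_iff hp).2 hpn
  have h' : ∀ n : ℕ, n • L p ≤ L q := fun n => by
    rw [← hL.map_pow hp]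
    exact hL.mono (pow_ne_zero n hp) (h n)
  rw [mk_lt_mk]
  intro n
  rw [abs_of_pos hp0, abs_of_nonneg (by simpa using h' 0)]
  refine lt_of_lt_of_le ?_ (h' (n + 1))
  rw [succ_nsmul]
  exact lt_add_of_pos_right _ hp0

/-- `h` sends the logarithm of `p` to that of the slowly growing `u` attached to `p`. -/
theorem exists_isRegressive : ∃ h : G → G, OrderedRatModule.IsRegressive h := by
  obtain ⟨F, hF⟩ := exists_slow_growth (M := M)
  have hex : ∀ g : G, ∃ h : G, 0 < g → ∃ p u : M, IsPowTwo p ∧ L p = g ∧ IsPowTwo u ∧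
      L u = h ∧ IsNonstandard u ∧ (∀ n : ℕ, u ^ n ≤ p) ∧
      ∀ v, IsPowTwo v → u < v → p < F v := by
    intro g
    by_cases hg : 0 < g
    · obtain ⟨p, hp, hpn, hpg⟩ := hL.exists_nonstandard_eq hg
      obtain ⟨u, hu, hun, h1, h2⟩ := hF p hp hpn
      exact ⟨L u, fun _ => ⟨p, u, hp, hpg, hu, rfl, hun, h1, h2⟩⟩
    · exact ⟨0, fun h => absurd h hg⟩
  choose h hh using hex
  refine ⟨h, fun x hx => ?_, fun b => ?_⟩
  · obtain ⟨p, u, hp, rfl, hu, hux, hun, h1, -⟩ := hh x hx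
    rw [← hux]
    exact ⟨(hL.pos_iff hu.1).2 hun, hL.mk_lt_mk_of_pow_le hu.1 hun h1⟩
  · rcases le_or_gt b 0 with hb | hb
    · refine ⟨0, fun x hx hxb => ?_⟩
      obtain ⟨p, u, -, -, hu, hux, hun, -, -⟩ := hh x hx
      have := (hL.pos_iff hu.1).2 hun
      rw [hux] at this
      exact absurd (hxb.trans hb) this.not_ge
    · obtain ⟨q, hq, hqn, rfl⟩ := hL.exists_nonstandard_eq hb
      -- `L u ≤ L q` gives only `u ≤ n * q`; since `q` is nonstandard, `u ≤ q * q`, and doubling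
      -- makes the bound on `u` strict.
      refine ⟨L (F (2 * (q * q))), fun x hx hxb => ?_⟩
      obtain ⟨p, u, hp, rfl, hu, hux, -, -, h2⟩ := hh x hx
      rw [← hux, hL.le_iff u q hu.1 hq.1] at hxb
      obtain ⟨n, hn⟩ := hxb
      refine hL.mono hp.1 (h2 _ (hq.mul hq).two_mul ?_).le
      exact (hn.trans (mul_le_mul_left (hqn n).le q)).trans_lt (hq.mul hq).lt_two_mul

theorem hasDenseClasses : OrderedRatModule.HasDenseClasses G := by
  intro x y hx hxy
  have hy : 0 < |y| := by
    rw [abs_pos]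
    rintro rfl
    rw [mk_zero] at hxy
    exact absurd le_top hxy.not_ge
  obtain ⟨p, hp, hpn, rfl⟩ := hL.exists_nonstandard_eq hx
  obtain ⟨q, hq, hqn, hqy⟩ := hL.exists_nonstandard_eq hy
  rw [← mk_abs y, ← hqy] at hxy ⊢
  have h : ∀ n : ℕ, p ^ n ≤ q := fun n => by
    have := mk_lt_mk.1 hxy n
    rw [abs_of_pos hx, abs_of_pos (hqy ▸ hy), ← hL.map_pow hp.1] at this
    exact (hL.lt_of_lt hq.1 this).le
  obtain ⟨z, hz, h1, h2⟩ := exists_between_pow hp hpn h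
  have hzn : IsNonstandard z := hpn.mono (by simpa using h1 1)
  exact ⟨L z, (hL.pos_iff hz.1).2 hzn, hL.mk_lt_mk_of_pow_le hz.1 hzn h2,
    hL.mk_lt_mk_of_pow_le hp.1 hpn h1⟩

end

section

variable {M : Type*} [CommSemiring M] [LinearOrder M] [IsPeanoModel M]
  {N : Type*} [CommSemiring N] [LinearOrder N] [IsPeanoModel N]
  {G : Type*} [AddCommGroup G] [LinearOrder G] [IsOrderedAddMonoid G]
  {H : Type*} [AddCommGroup H] [LinearOrder H] [IsOrderedAddMonoid H]
  {L : M → G} {L' : N → H}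

theorem transfersRatios (hL : IsLogarithm L) (hL' : IsLogarithm L')
    (hSS : standardSystem M = standardSystem N) : OrderedRatModule.TransfersRatios G H := by
  intro x y x' hx hy hxy hx'
  obtain ⟨p, hp, hpn, rfl⟩ := hL.exists_nonstandard_eq hx
  obtain ⟨q, hq, hqn, rfl⟩ := hL.exists_nonstandard_eq hy
  obtain ⟨p', hp', hpn', rfl⟩ := hL'.exists_nonstandard_eq hx'
  obtain ⟨n₀, hn₀⟩ : ∃ n₀ : ℕ, p ≤ q ^ n₀ := by
    obtain ⟨n, hn⟩ := mk_le_mk.1 hxy.ge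
    rw [abs_of_pos hx, abs_of_pos hy, ← hL.map_pow hq.1, hL.le_iff p _ hp.1 (hq.pow n).1] at hn
    obtain ⟨k, hk⟩ := hn
    -- One more factor `q` absorbs the standard factor `k`.
    refine ⟨n + 1, hk.trans ?_⟩
    rw [pow_succ']
    exact mul_le_mul_left (hqn k).le _
  obtain ⟨q', hq', hqn', h⟩ := exists_pow_le_iff hSS hp hpn hq hqn hp' hpn' hn₀
  refine ⟨L' q', ((hL'.pos_iff hq'.1).2 hqn').le, fun m n => ?_⟩
  rw [← hL.map_pow hp.1, ← hL.map_pow hq.1, ← hL'.map_pow hp'.1, ← hL'.map_pow hq'.1]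
  -- `L` forgets finite factors: strict inequalities in `G` descend to `M`, but only weak ones
  -- survive the passage from `N` to `H`. This explains the form of `TransfersRatios`.
  constructor
  · intro hlt
    exact hL'.mono (hp'.pow m).1 ((h m n).1 (hL.lt_of_lt (hq.pow n).1 hlt).le)
  · intro hlt
    have h1 := hL.lt_of_lt (hp.pow m).1 hlt
    refine hL'.mono (hq'.pow n).1 (le_of_not_ge fun h2 => ?_)
    exact absurd ((h m n).2 h2) h1.not_ge

theorem nonempty_orderAddMonoidIso (hL : IsLogarithm L) (hL' : IsLogarithm L')
    (hM : IsOmegaOneLike M) (hN : IsOmegaOneLike N) (hSS : standardSystem M = standardSystem N) :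
    Nonempty (G ≃+o H) := by
  let _ : Module ℚ G := OrderedRatModule.ofDivisible hL.divisible
  let _ : Module ℚ H := OrderedRatModule.ofDivisible hL'.divisible
  have := hL.uncountable hM
  have := hL'.uncountable hN
  obtain ⟨h, hh⟩ := hL.exists_isRegressive
  obtain ⟨k, hk⟩ := hL'.exists_isRegressive
  exact OrderedRatModule.nonempty_orderAddMonoidIso (hL.countable_abs_le hM)
    (hL'.countable_abs_le hN) hh hk hL.hasDenseClasses hL'.hasDenseClasses
    (hL.transfersRatios hL' hSS) (hL'.transfersRatios hL hSS.symm)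

end

end IsLogarithm

end PeanoModel

/-! ### Archimedean classes in algebraic extensions -/

section AlgebraicExtension

variable {K : Type*} [Field K] [LinearOrder K] [IsStrictOrderedRing K]

/-- In a vanishing sum, two nonzero terms have the same archimedean class. -/
theorem exists_mk_eq_mk_of_sum_eq_zero {ι : Type*} {s : Finset ι} (hs : s.Nonempty) {f : ι → K}
    (hf : ∀ i ∈ s, f i ≠ 0) (hsum : ∑ i ∈ s, f i = 0) :
    ∃ i ∈ s, ∃ j ∈ s, i ≠ j ∧ mk (f i) = mk (f j) := by
  classical
  by_contra! h
  obtain ⟨i, hi, hmin⟩ := s.exists_min_image (fun i => mk (f i)) hs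
  have h1 : mk (f i) < addValuation K (∑ j ∈ s.erase i, f j) :=
    (addValuation K).map_lt_sum (mt mk_eq_top_iff.1 (hf i hi)) fun j hj => by
      rw [Finset.mem_erase] at hj
      exact (hmin j hj.2).lt_of_ne (h i hi j hj.2 hj.1.symm)
  rw [← Finset.add_sum_erase s f hi] at hsum
  rw [addValuation_apply, ← neg_eq_of_add_eq_zero_right hsum, mk_neg] at h1
  exact h1.false

/-- Some multiple of the archimedean class of a nonzero element algebraic over a subfield is the
class of an element of the subfield. -/
theorem exists_nsmul_mk_eq_of_isAlgebraic (F : Subfield K) {x : K} (hx : x ≠ 0)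
    (halg : IsAlgebraic F x) : ∃ n : ℕ, n ≠ 0 ∧ ∃ y ∈ F, y ≠ 0 ∧ n • mk x = mk y := by
  obtain ⟨p, hp, hpx⟩ := halg
  rw [Polynomial.aeval_eq_sum_range, ← Finset.sum_filter_of_ne
    (p := fun i => p.coeff i ≠ 0) (by
      intro i _ hi hi'
      exact hi (by rw [hi', zero_smul]))] at hpx
  have hne : ∀ i, p.coeff i ≠ 0 → p.coeff i • x ^ i ≠ 0 := fun i hi =>
    smul_ne_zero hi (pow_ne_zero i hx)
  obtain ⟨i, hi, j, hj, hij, heq⟩ := exists_mk_eq_mk_of_sum_eq_zero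
    ⟨p.natDegree, by simp [hp]⟩ (fun i hi => hne i (Finset.mem_filter.1 hi).2) hpx
  have key : ∀ i j : ℕ, i < j → p.coeff i ≠ 0 → p.coeff j ≠ 0 →
      mk (p.coeff i • x ^ i) = mk (p.coeff j • x ^ j) →
      ∃ n : ℕ, n ≠ 0 ∧ ∃ y ∈ F, y ≠ 0 ∧ n • mk x = mk y := by
    intro i j hij hi hj heq
    have hi' : (p.coeff i : K) ≠ 0 := by exact_mod_cast hi
    have hj' : (p.coeff j : K) ≠ 0 := by exact_mod_cast hj
    -- Two terms of the same class with exponents `i < j` give `x ^ (j - i)` the class of the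
    -- quotient of the coefficients.
    refine ⟨j - i, by omega, (p.coeff i : K) / p.coeff j,
      div_mem (SetLike.coe_mem _) (SetLike.coe_mem _), div_ne_zero hi' hj', ?_⟩
    rw [Subfield.smul_def, Subfield.smul_def, smul_eq_mul, smul_eq_mul] at heq
    have h1 : mk (x ^ (j - i) * (p.coeff j * x ^ i)) = mk (p.coeff i / p.coeff j *
        (p.coeff j * x ^ i) : K) := by
      rw [← mul_assoc, mul_comm (x ^ (j - i)), mul_assoc, ← pow_add, Nat.sub_add_cancel hij.le,
        ← heq, ← mul_assoc, div_mul_cancel₀ _ hj']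
    rw [mk_mul, mk_mul] at h1
    rw [← mk_pow]
    refine add_right_cancel_of_ne_top ?_ h1
    exact mt mk_eq_top_iff.1 (mul_ne_zero hj' (pow_ne_zero i hx))
  rcases hij.lt_or_gt with h | h
  · exact key i j h (Finset.mem_filter.1 hi).2 (Finset.mem_filter.1 hj).2 heq
  · exact key j i h (Finset.mem_filter.1 hj).2 (Finset.mem_filter.1 hi).2 heq.symm

end AlgebraicExtension

/-! ### The value group of the real closure -/

namespace PeanoModel

variable {M : Type*} [CommSemiring M] [LinearOrder M] [IsPeanoModel M]
  {K : Type*} [Field K] [LinearOrder K] [IsStrictOrderedRing K]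

/-- The elements of the subfield generated by `M` are fractions of differences of elements of
`M`. -/
theorem exists_mul_eq_sub_of_mem_closure {i : M →+* K} (hi : Function.Injective i) {x : K}
    (hx : x ∈ Subfield.closure (Set.range i)) : ∃ a b c, c ≠ 0 ∧ x * i c = i a - i b := by
  have hi0 : ∀ {c : M}, c ≠ 0 → i c ≠ 0 := fun hc h => hc (hi (by rw [h, map_zero]))
  induction hx using Subfield.closure_induction with
  | mem x hx =>
    obtain ⟨a, rfl⟩ := hx
    exact ⟨a, 0, 1, one_ne_zero, by simp⟩
  | one => exact ⟨1, 0, 1, one_ne_zero, by simp⟩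
  | add x y _ _ hx hy =>
    obtain ⟨a, b, c, hc, h⟩ := hx
    obtain ⟨a', b', c', hc', h'⟩ := hy
    refine ⟨a * c' + a' * c, b * c' + b' * c, c * c', mul_ne_zero hc hc', ?_⟩
    simp only [map_mul, map_add]
    linear_combination i c' * h + i c * h'
  | neg x _ hx =>
    obtain ⟨a, b, c, hc, h⟩ := hx
    exact ⟨b, a, c, hc, by linear_combination -h⟩
  | inv x _ hx =>
    obtain ⟨a, b, c, hc, h⟩ := hx
    by_cases hx0 : x = 0
    · exact ⟨0, 0, 1, one_ne_zero, by simp [hx0]⟩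
    rcases le_total a b with hab | hba
    · obtain ⟨d, rfl⟩ := exists_add_of_le hab
      have hd : d ≠ 0 := by
        rintro rfl
        simp [hx0, hi0 hc] at h
      refine ⟨0, c, d, hd, ?_⟩
      rw [map_add] at h
      rw [inv_mul_eq_iff_eq_mul₀ hx0, map_zero]
      linear_combination h
    · obtain ⟨d, rfl⟩ := exists_add_of_le hba
      have hd : d ≠ 0 := by
        rintro rfl
        simp [hx0, hi0 hc] at h
      refine ⟨c, 0, d, hd, ?_⟩
      rw [map_add] at h
      rw [inv_mul_eq_iff_eq_mul₀ hx0, map_zero]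
      linear_combination -h
  | mul x y _ _ hx hy =>
    obtain ⟨a, b, c, hc, h⟩ := hx
    obtain ⟨a', b', c', hc', h'⟩ := hy
    refine ⟨a * a' + b * b', a * b' + b * a', c * c', mul_ne_zero hc hc', ?_⟩
    simp only [map_mul, map_add]
    linear_combination y * i c' * h + (i a - i b) * h'

/-- Up to sign, a difference of two elements of `M` is again in `M`, so every nonzero fraction has
the class of a quotient of elements of `M`. -/
theorem exists_mk_add_mk_eq_of_mem_closure {i : M →+* K} (hi : Function.Injective i) {x : K}
    (hx : x ∈ Subfield.closure (Set.range i)) (hx0 : x ≠ 0) :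
    ∃ d c, d ≠ 0 ∧ c ≠ 0 ∧ mk x + mk (i c) = mk (i d) := by
  obtain ⟨a, b, c, hc, h⟩ := exists_mul_eq_sub_of_mem_closure hi hx
  have hic : i c ≠ 0 := fun h => hc (hi (by rw [h, map_zero]))
  have hne : i a - i b ≠ 0 := h ▸ mul_ne_zero hx0 hic
  rcases le_total a b with hab | hba
  · obtain ⟨d, rfl⟩ := exists_add_of_le hab
    refine ⟨d, c, ?_, hc, ?_⟩
    · rintro rfl
      simp at hne
    · rw [← mk_mul, h, map_add, sub_add_cancel_left, mk_neg]
  · obtain ⟨d, rfl⟩ := exists_add_of_le hba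
    refine ⟨d, c, ?_, hc, ?_⟩
    · rintro rfl
      simp at hne
    · rw [← mk_mul, h, map_add, add_sub_cancel_left]

/-- The archimedean class of a nonzero element as an element of the value group. -/
noncomputable def classOf {x : K} (hx : x ≠ 0) : StandardValueGroup K where
  val := mk x
  neg := mk x⁻¹
  val_neg := by rw [← mk_mul, mul_inv_cancel₀ hx, mk_one]
  neg_val := by rw [← mk_mul, inv_mul_cancel₀ hx, mk_one]

theorem exists_classOf_eq (g : StandardValueGroup K) : ∃ (x : K) (hx : x ≠ 0), classOf hx = g := by
  obtain ⟨x, hx⟩ := mk_surjective (M := K) g.val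
  refine ⟨x, ?_, AddUnits.ext hx⟩
  rintro rfl
  have h := g.val_neg
  rw [← hx, mk_zero, top_add] at h
  exact top_ne_zero h

/-- The map sending an element of `M` to the opposite of its standard valuation in a real closure
of `M`. -/
noncomputable def logClass {i : M →+* K} (hi : Function.Injective i) (a : M) :
    StandardValueGroup K :=
  open Classical in
  -- The value at `0` is arbitrary, as `IsLogarithm` concerns nonzero arguments only. The minus sign
  -- makes the map increasing.
  if h : a = 0 then 0 else -classOf (x := i a) fun h' => h (hi (by rw [h', map_zero]))

/-- The first two properties are those of a valuation. The last one holds because the extension is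
algebraic: a multiple of each value comes from the fraction field, where values are differences of
values from `M`. -/
theorem isLogarithm_logClass {i : M →+* K} (hi : IsRealClosure i) :
    IsLogarithm (logClass hi.strictMono.injective) := by
  have hinj := hi.strictMono.injective
  have hval : ∀ a, (ha : a ≠ 0) → logClass hinj a = -classOf (x := i a)
      fun h' => ha (hinj (by rw [h', map_zero])) := fun a ha => dif_neg ha
  have hpos : ∀ a, 0 ≤ i a := fun a => by
    rw [← map_zero i]
    exact hi.strictMono.monotone zero_le
  refine ⟨fun a b ha hb => ?_, fun a b ha hb => ?_, fun g => ?_⟩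
  · rw [hval a ha, hval b hb, hval _ (mul_ne_zero ha hb), ← neg_add, neg_inj]
    ext
    change mk (i (a * b)) = mk (i a) + mk (i b)
    rw [map_mul, mk_mul]
  · rw [hval a ha, hval b hb, neg_le_neg_iff]
    change mk (i b) ≤ mk (i a) ↔ _
    rw [mk_le_mk, abs_of_nonneg (hpos a), abs_of_nonneg (hpos b)]
    refine exists_congr fun n => ?_
    rw [nsmul_eq_mul, ← map_natCast i, ← map_mul, hi.strictMono.le_iff_le]
  · obtain ⟨x, hx, rfl⟩ := exists_classOf_eq g
    obtain ⟨n, hn, y, hy, hy0, hxy⟩ := exists_nsmul_mk_eq_of_isAlgebraic _ hx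
      (hi.isAlgebraic.isAlgebraic x)
    obtain ⟨d, c, hd, hc, hdc⟩ := exists_mk_add_mk_eq_of_mem_closure hinj hy hy0
    refine ⟨n, hn, d, c, hd, hc, ?_⟩
    rw [hval d hd, hval c hc, ← sub_eq_add_neg, sub_eq_iff_eq_add, neg_add_eq_sub, eq_sub_iff_add_eq]
    ext
    rw [AddUnits.val_add, AddUnits.val_nsmul_eq_nsmul_val]
    change n • mk x + mk (i c) = mk (i d)
    rw [hxy, hdc]

end PeanoModel

/-- `R(M)` and `R(N)` are arbitrary real closures of `M` and `N`; the conclusion is an isomorphism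
of ordered groups. -/
theorem theorem3p1
    {M : Type*} [CommSemiring M] [LinearOrder M] [IsPeanoModel M]
    {N : Type*} [CommSemiring N] [LinearOrder N] [IsPeanoModel N]
    (hM : IsOmegaOneLike M) (hN : IsOmegaOneLike N)
    (hSS : standardSystem M = standardSystem N)
    {RM : Type*} [Field RM] [LinearOrder RM] [IsStrictOrderedRing RM]
    (i : M →+* RM) (hi : IsRealClosure i)
    {RN : Type*} [Field RN] [LinearOrder RN] [IsStrictOrderedRing RN]
    (j : N →+* RN) (hj : IsRealClosure j) :
    Nonempty (StandardValueGroup RM ≃+o StandardValueGroup RN) :=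
  (PeanoModel.isLogarithm_logClass hi).nonempty_orderAddMonoidIso
    (PeanoModel.isLogarithm_logClass hj) hM hN hSS
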